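/- **Conventions.** For a finite-dimensional Euclidean space $V$, let $S^2_B(\Lambda^2V^*)$ be the space of algebraic curvature tensors on $V$, i.e. of the symmetric bilinear forms $R$ on $\Lambda^2V$ that satisfy the first Bianchi identity $R(u\wedge v, w\wedge z)+R(v\wedge w, u\wedge z)+R(w\wedge u, v\wedge z)=0$, with the scalar product $\langle R,S\rangle=\mathrm{tr}(R\circ S)$, where $R$ and $S$ are regarded as self-adjoint endomorphisms of $\Lambda^2V$. *Second Bianchi identity.* If $\dim V=n$, a tuple $(T_1,\dots,T_n)$ of elements of $S^2_B(\Lambda^2V^*)$ satisfies the second Bianchi identity with respect to an orthonormal basis $(b_1,\dots,b_n)$ of $V$ if $$T_i(b_j\wedge b_k)+T_j(b_k\wedge b_i)+T_k(b_i\wedge b_j)=0\quad\text{for all } i,j,k;$$ it satisfies the second Bianchi identity if it does so with respect to some orthonormal basis. *Supporting submanifolds.* Let $\Omega$ be a closed subset of $S^2_B(\Lambda^2V^*)$ and $R\in\partial\Omega$. A supporting submanifold of $\Omega$ in $R$ is a smooth two-sided hypersurface $N\subseteq S^2_B(\Lambda^2V^*)$ with $R\in N$ for which there is an open neighbourhood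 $U$ of $R$ such that $U\setminus N$ has exactly two connected components $U_1,U_2$, where $\Omega\cap\overline U\subseteq\overline{U_1}$, and the unit normal of $N$ at $R$, suitably oriented, points from $U_1$ into $U_2$. We orient $N$ by a continuous unit normal field $\mathbf n$ for which $\mathbf n_R$ points from $U_1$ into $U_2$, i.e. away from $\Omega$. The second fundamental form of $N$ at $S\in N$ is $\mathrm{II}^N_S(X,Y)=\langle D_XY,\mathbf n_S\rangle$ for $X,Y\in T_SN$ (so it is negative semidefinite at outward oriented boundaries of convex sets). *Bianchi-convexity.* For $\epsilon>0$ consider the condition $$\sum_{i=1}^n \mathrm{II}^N_S(T_i,T_i)\le\epsilon\sum_{i=1}^n\|T_i\|^2\quad\text{for all } S\in N \text{ and all } (T_1,\dots,T_n)\in(T_SN)^n \text{ satisfying the second Bianchi identity.}\qquad(*_\epsilon)$$ The closed set $\Omega$ is Bianchi-convex if for all $\epsilon>0$ and all $R\in\partial\Omega$ there is a supporting submanifold of $\Omega$ in $R$ that satisfies $(*_\epsilon)$. **Lemma.** Let $(M,g)$ be an $n$-dimensional Riemannian manifold with Levi-Civita connection $\nabla$, and let $C$ be a closed subset of the bundle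 $S^2_B(\Lambda^2T^*M)$ of algebraic curvature tensors that is invariant under parallel transport with respect to $\nabla$ and whose fibres $C_y\subseteq S^2_B(\Lambda^2T_y^*M)$, $y\in M$, are Bianchi-convex. Let $R$ be a smooth section of $S^2_B(\Lambda^2T^*M)$ with $R(y)\in C_y$ for all $y\in M$, and let $x\in M$ be a point with $R(x)\in\partial C_x$. Assume that $(b_1,\dots,b_n)$ is an orthonormal basis of $T_xM$ such that $(\nabla_{b_1}R,\dots,\nabla_{b_n}R)$ satisfies the second Bianchi identity with respect to $(b_1,\dots,b_n)$. Let $\epsilon>0$ and let $N$ be a supporting submanifold of $C_x$ in $R(x)$ that satisfies $(*_\epsilon)$. Then $$\big\langle(\Delta_gR)(x),\mathbf n_{R(x)}\big\rangle\le\epsilon\sum_{i=1}^n\|\nabla_{b_i}R\|^2,$$ where $\mathbf n_{R(x)}$ is the unit normal of $N$ at $R(x)$ that points away from $C_x$, and $\Delta_gR=\mathrm{tr}_g\nabla^2R$, i.e. $(\Delta_gR)(x)$ is the sum of the second covariant derivatives at $x$ of $R$ along geodesics through $x$ with orthonormal initial velocities. -/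

import Mathlib

open Set Filter
open scoped Topology ContDiff

noncomputable section

section Alg
variable (V : Type*) [NormedAddCommGroup V] [InnerProductSpace ℝ V]

/-- The algebraic curvature tensors on `V`: the elements of `S²(Λ²V*)` that satisfy the first
Bianchi identity, written as 4-linear forms `(u, v, w, z) ↦ R(u ∧ v, w ∧ z)`. -/
def algCurvSubmodule : Submodule ℝ (MultilinearMap ℝ (fun _ : Fin 4 => V) ℝ) where
  carrier := {R | (∀ u v w z, R ![u, v, w, z] = -R ![v, u, w, z]) ∧
    (∀ u v w z, R ![u, v, w, z] = R ![w, z, u, v]) ∧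
    ∀ u v w z, R ![u, v, w, z] + R ![v, w, u, z] + R ![w, u, v, z] = 0}
  zero_mem' := by simp
  add_mem' := by
    rintro R S ⟨h1, h2, h3⟩ ⟨k1, k2, k3⟩
    refine ⟨fun u v w z => ?_, fun u v w z => ?_, fun u v w z => ?_⟩
    · simp only [add_apply]
      linear_combination h1 u v w z + k1 u v w z
    · simp only [add_apply]
      linear_combination h2 u v w z + k2 u v w z
    · simp only [add_apply]
      linear_combination h3 u v w z + k3 u v w z
  smul_mem' := by
    rintro c R ⟨h1, h2, h3⟩
    refine ⟨fun u v w z => ?_, fun u v w z => ?_, fun u v w z => ?_⟩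
    · simp only [smul_apply, smul_eq_mul]
      linear_combination c * h1 u v w z
    · simp only [smul_apply, smul_eq_mul]
      linear_combination c * h2 u v w z
    · simp only [smul_apply, smul_eq_mul]
      linear_combination c * h3 u v w z

/-- The space of algebraic curvature tensors on `V`. -/
def AlgCurv : Type _ := ↥(algCurvSubmodule V)

namespace AlgCurv

instance : AddCommGroup (AlgCurv V) := inferInstanceAs (AddCommGroup ↥(algCurvSubmodule V))
instance : Module ℝ (AlgCurv V) := inferInstanceAs (Module ℝ ↥(algCurvSubmodule V))

variable {V}

/-- `R.eval x y z w` is `R(x ∧ y, z ∧ w)`. -/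
def eval (R : AlgCurv V) (x y z w : V) : ℝ := R.1 ![x, y, z, w]

section Norm
variable (V)
variable [FiniteDimensional ℝ V]

/-- The scalar product `⟨R, S⟩ = tr (R ∘ S)` of two algebraic curvature tensors, considered as
self-adjoint endomorphisms of `Λ²V`: the sum of `R(e_i ∧ e_j, e_k ∧ e_l) S(e_i ∧ e_j, e_k ∧ e_l)`
over `i < j` and `k < l`, which is a quarter of the sum over all `i, j, k, l`. -/
@[reducible] def innerCore : InnerProductSpace.Core ℝ (AlgCurv V) where
  inner R S := (1 / 4) * ∑ f : Fin 4 → Fin (Module.finrank ℝ V),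
    R.1 (fun a => stdOrthonormalBasis ℝ V (f a)) * S.1 (fun a => stdOrthonormalBasis ℝ V (f a))
  conj_inner_symm R S := by simp [mul_comm]
  re_inner_nonneg R := by
    simp only [RCLike.re_to_real]
    exact mul_nonneg (by norm_num) (Finset.sum_nonneg fun _ _ => mul_self_nonneg _)
  add_left R S T := by
    rw [← mul_add, ← Finset.sum_add_distrib]
    congr 1
    exact Finset.sum_congr rfl fun f _ => add_mul _ _ _
  smul_left R S c := by
    change (1 / 4 : ℝ) * ∑ f : Fin 4 → Fin (Module.finrank ℝ V),
      (c * R.1 (fun a => stdOrthonormalBasis ℝ V (f a))) *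
        S.1 (fun a => stdOrthonormalBasis ℝ V (f a)) =
      c * ((1 / 4 : ℝ) * ∑ f : Fin 4 → Fin (Module.finrank ℝ V),
        R.1 (fun a => stdOrthonormalBasis ℝ V (f a)) *
          S.1 (fun a => stdOrthonormalBasis ℝ V (f a)))
    simp only [mul_assoc, ← Finset.mul_sum]
    ring
  definite R h := by
    have h' := (mul_eq_zero.1 h).resolve_left (by norm_num)
    rw [Finset.sum_eq_zero_iff_of_nonneg fun _ _ => mul_self_nonneg _] at h'
    refine Subtype.ext (Module.Basis.ext_multilinear (fun _ => (stdOrthonormalBasis ℝ V).toBasis)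
      fun f => ?_)
    have h2 := mul_self_eq_zero.1 (h' f (Finset.mem_univ _))
    simp only [OrthonormalBasis.coe_toBasis]
    exact h2

instance : NormedAddCommGroup (AlgCurv V) :=
  (innerCore V).toNormedAddCommGroup
instance : InnerProductSpace ℝ (AlgCurv V) := InnerProductSpace.ofCore (innerCore V).toCore
instance : FiniteDimensional ℝ (AlgCurv V) :=
  inferInstanceAs (FiniteDimensional ℝ ↥(algCurvSubmodule V))
end Norm

variable {W : Type*} [NormedAddCommGroup W] [InnerProductSpace ℝ W]

/-- The pullback of an algebraic curvature tensor by a linear map: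
`(P*R)(u, v, w, z) = R(Pu, Pv, Pw, Pz)`. -/
def pullback (P : V →L[ℝ] W) (R : AlgCurv W) : AlgCurv V :=
  ⟨R.1.compLinearMap fun _ => P.toLinearMap, by
    have e (u v w z : V) : (R.1.compLinearMap fun _ => P.toLinearMap) ![u, v, w, z] =
        R.1 ![P u, P v, P w, P z] := by
      rw [MultilinearMap.compLinearMap_apply]
      congr 1
      ext a
      fin_cases a <;> rfl
    obtain ⟨h1, h2, h3⟩ := R.2
    refine ⟨fun u v w z => ?_, fun u v w z => ?_, fun u v w z => ?_⟩ <;> simp only [e]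
    · exact h1 _ _ _ _
    · exact h2 _ _ _ _
    · exact h3 _ _ _ _⟩

/-- The action of an endomorphism `A` of `V` as a derivation:
`R(Au, v, w, z) + R(u, Av, w, z) + R(u, v, Aw, z) + R(u, v, w, Az)`. -/
def act (A : V →L[ℝ] V) (R : AlgCurv V) : AlgCurv V :=
  ⟨∑ a : Fin 4, R.1.compLinearMap (Function.update (fun _ => LinearMap.id) a A.toLinearMap), by
    have e (u v w z : V) :
        (∑ a : Fin 4, R.1.compLinearMap (Function.update (fun _ => LinearMap.id) a A.toLinearMap))
          ![u, v, w, z] = R.1 ![A u, v, w, z] + R.1 ![u, A v, w, z] + R.1 ![u, v, A w, z]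
            + R.1 ![u, v, w, A z] := by
      rw [sum_apply, Fin.sum_univ_four]
      simp only [MultilinearMap.compLinearMap_apply]
      congr 1
      · congr 1
        · congr 1 <;> (congr 1; ext a; fin_cases a <;> rfl)
        · congr 1; ext a; fin_cases a <;> rfl
      · congr 1; ext a; fin_cases a <;> rfl
    obtain ⟨h1, h2, h3⟩ := R.2
    refine ⟨fun u v w z => ?_, fun u v w z => ?_, fun u v w z => ?_⟩ <;> simp only [e]
    · linear_combination h1 (A u) v w z + h1 u (A v) w z + h1 u v (A w) z + h1 u v w (A z)
    · linear_combination h2 (A u) v w z + h2 u (A v) w z + h2 u v (A w) z + h2 u v w (A z)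
    · linear_combination h3 (A u) v w z + h3 u (A v) w z + h3 u v (A w) z + h3 u v w (A z)⟩
end AlgCurv
end Alg

section Hypersurfaces
variable {W : Type*} [NormedAddCommGroup W] [InnerProductSpace ℝ W]

/-- `N` is a smooth embedded submanifold of codimension one with unit normal field `ν`: near each
point, `N` is the zero set of a smooth function `f` whose gradient on `N` is a positive multiple
of `ν`. The tangent space of `N` at `p` is then the orthogonal complement of `ν p`. -/
def IsCoorientedHypersurface (N : Set W) (ν : W → W) : Prop :=
  ∀ p ∈ N, ∃ V : Set W, IsOpen V ∧ p ∈ V ∧ ∃ f : W → ℝ, ContDiffOn ℝ ∞ f V ∧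
    (∀ q ∈ V, q ∈ N ↔ f q = 0) ∧
    ∀ q ∈ N ∩ V, ‖ν q‖ = 1 ∧ ∃ c : ℝ, 0 < c ∧ fderiv ℝ f q = c • innerSL ℝ (ν q)

/-- The second fundamental form `⟨D_X Y, ν⟩` at `p ∈ N` of a hypersurface `N` with unit normal
field `ν`, for tangent vectors `X`, `Y` at `p`, where `Y` is extended to the tangential field
`q ↦ Y - ⟨Y, ν q⟩ ν q` along `N`. -/
def secondFundamentalForm (N : Set W) (ν : W → W) (p X Y : W) : ℝ :=
  inner ℝ (fderivWithin ℝ (fun q => Y - inner ℝ Y (ν q) • ν q) N p X) (ν p)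

/-- `N` is a supporting submanifold of `C` in `x₀`, with unit normal field `ν` that points away
from `C` at `x₀`: some open neighbourhood `U` of `x₀` is cut by `N` into exactly two connected
components `U₁` and `U₂`, the closure of `U₁` contains `C ∩ closure U`, and `ν x₀` points from
`U₁` to `U₂`. -/
def IsSupportingHypersurface (C N : Set W) (ν : W → W) (x₀ : W) : Prop :=
  IsCoorientedHypersurface N ν ∧ x₀ ∈ N ∧
  ∃ U U₁ U₂ : Set W, IsOpen U ∧ x₀ ∈ U ∧
    IsOpen U₁ ∧ IsOpen U₂ ∧ IsConnected U₁ ∧ IsConnected U₂ ∧ Disjoint U₁ U₂ ∧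
    U \ N = U₁ ∪ U₂ ∧ C ∩ closure U ⊆ closure U₁ ∧
    ∀ᶠ t : ℝ in 𝓝[>] 0, x₀ - t • ν x₀ ∈ U₁ ∧ x₀ + t • ν x₀ ∈ U₂

end Hypersurfaces

section BianchiConvex
variable {n : ℕ} {V : Type*} [NormedAddCommGroup V] [InnerProductSpace ℝ V]

/-- The second Bianchi identity of `(T₁, …, Tₙ)` with respect to an orthonormal basis `b`:
`T_i(b_j ∧ b_k) + T_j(b_k ∧ b_i) + T_k(b_i ∧ b_j) = 0` in `Λ²V` for all `i`, `j`, `k`. -/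
def SatisfiesSecondBianchi (b : OrthonormalBasis (Fin n) ℝ V) (T : Fin n → AlgCurv V) : Prop :=
  ∀ i j k, ∀ u v : V,
    (T i).eval (b j) (b k) u v + (T j).eval (b k) (b i) u v + (T k).eval (b i) (b j) u v = 0

variable [FiniteDimensional ℝ V]

/-- The inequality `∑ i, II_S(T_i, T_i) ≤ ε ∑ i, ‖T_i‖²` for all `S ∈ N` and all `n`-tuples of
tangent vectors `T_i` of `N` at `S` that satisfy the second Bianchi identity. -/
def BianchiBound (n : ℕ) (N : Set (AlgCurv V)) (ν : AlgCurv V → AlgCurv V) (ε : ℝ) : Prop :=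
  ∀ S ∈ N, ∀ T : Fin n → AlgCurv V, (∀ i, inner ℝ (T i) (ν S) = 0) →
    (∃ b : OrthonormalBasis (Fin n) ℝ V, SatisfiesSecondBianchi b T) →
    ∑ i, secondFundamentalForm N ν S (T i) (T i) ≤ ε * ∑ i, ‖T i‖ ^ 2

/-- Bianchi-convex sets of algebraic curvature tensors on an `n`-dimensional space. -/
def IsBianchiConvex (n : ℕ) (C : Set (AlgCurv V)) : Prop :=
  IsClosed C ∧ ∀ ε > 0, ∀ R ∈ frontier C, ∃ (N : Set (AlgCurv V)) (ν : AlgCurv V → AlgCurv V),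
    IsSupportingHypersurface C N ν R ∧ BianchiBound n N ν ε

end BianchiConvex

open Bundle FiberBundle VectorField
open scoped Manifold

section LC
variable {E : Type*} [NormedAddCommGroup E] [NormedSpace ℝ E]
  {H : Type*} [TopologicalSpace H] {I : ModelWithCorners ℝ E H}
  {M : Type*} [TopologicalSpace M] [ChartedSpace H M]

instance tangentSpace_finiteDimensional [FiniteDimensional ℝ E] (x : M) :
    FiniteDimensional ℝ (TangentSpace I x) :=
  inferInstanceAs (FiniteDimensional ℝ E)

variable [IsManifold I ∞ M]

/-- The linear map `T_xM → T_yM` given by the trivialization of the tangent bundle around `x`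
(it is zero if `y` is outside the domain of that trivialization). -/
def tangentTransition (x y : M) : TangentSpace I x →L[ℝ] TangentSpace I y :=
  ((trivializationAt E (TangentSpace I) x).symmL ℝ y).comp
    ((trivializationAt E (TangentSpace I) x).continuousLinearMapAt ℝ x)

/-- Extension of a tangent vector `v` at `x` to a vector field, smooth near `x` and depending
linearly on `v`: it has constant coordinates in the trivialization around `x`. -/
def extendField {x : M} (v : TangentSpace I x) : Π y : M, TangentSpace I y :=
  fun y => tangentTransition x y v

theorem extendField_add {x : M} (u v : TangentSpace I x) :
    extendField (u + v) = extendField u + extendField v :=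
  funext fun y => (tangentTransition x y).map_add u v

theorem extendField_smul {x : M} (c : ℝ) (v : TangentSpace I x) :
    extendField (c • v) = c • extendField v :=
  funext fun y => (tangentTransition x y).map_smul c v

theorem extendField_eventuallyEq {x : M} (v : TangentSpace I x) :
    ∀ᶠ y in 𝓝 x, extendField v y = extend E v y := by
  have h : x ∈ (trivializationAt E (TangentSpace I) x).baseSet := mem_baseSet_trivializationAt' x
  filter_upwards [(trivializationAt E (TangentSpace I) x).open_baseSet.mem_nhds h] with y hy
  simp only [extendField, tangentTransition, extend, ContinuousLinearMap.comp_apply,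
    Trivialization.continuousLinearMapAt_apply, Trivialization.coe_linearMapAt_of_mem _ h]
  exact Trivialization.symmₗ_apply (R := ℝ) _ hy _

@[simp] theorem extendField_self {x : M} (v : TangentSpace I x) : extendField v x = v :=
  (extendField_eventuallyEq v).self_of_nhds.trans (extend_apply_self (F := E) v)

theorem mdifferentiableAt_extendField {x : M} (v : TangentSpace I x) :
    MDiffAt (T% (extendField v)) x := by
  refine (mdifferentiableAt_extend I E v).congr_of_eventuallyEq ?_
  filter_upwards [extendField_eventuallyEq v] with y hy
  simp only [hy]

variable [RiemannianBundle (fun x : M => TangentSpace I x)]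
  [IsContMDiffRiemannianBundle I ∞ E (fun x : M => TangentSpace I x)]

variable (I) in
/-- Right-hand side of the Koszul formula for arbitrary vector fields. -/
def koszul (U Y W : Π x : M, TangentSpace I x) (x : M) : ℝ :=
  (mvfderiv I (fun y => inner ℝ (Y y) (W y)) x (U x)
    + mvfderiv I (fun y => inner ℝ (U y) (W y)) x (Y x)
    - mvfderiv I (fun y => inner ℝ (U y) (Y y)) x (W x)
    + inner ℝ (mlieBracket I U Y x) (W x)
    - inner ℝ (mlieBracket I U W x) (Y x)
    - inner ℝ (mlieBracket I Y W x) (U x)) / 2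

variable {U U' Y Y' W W' : Π x : M, TangentSpace I x} {x : M} [FiniteDimensional ℝ E]

theorem inner_mdiff (hY : MDiffAt (T% Y) x) (hW : MDiffAt (T% W) x) :
    MDiffAt (fun y => inner ℝ (Y y) (W y)) x :=
  MDifferentiableAt.inner_bundle (IB := I) (F := E) (E := fun x : M => TangentSpace I x)
    (b := fun y => y) hY hW

theorem koszul_add_left (hU : MDiffAt (T% U) x) (hU' : MDiffAt (T% U') x)
    (hY : MDiffAt (T% Y) x) (hW : MDiffAt (T% W) x) :
    koszul I (U + U') Y W x = koszul I U Y W x + koszul I U' Y W x := by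
  have : CompleteSpace E := FiniteDimensional.complete ℝ E
  simp only [koszul, Pi.add_apply, inner_add_left, inner_add_right, map_add,
    mlieBracket_add_left hU hU', mvfderiv_fun_add (inner_mdiff hU hW) (inner_mdiff hU' hW),
    mvfderiv_fun_add (inner_mdiff hU hY) (inner_mdiff hU' hY), add_apply]
  ring

theorem koszul_smul_left (c : ℝ) (hU : MDiffAt (T% U) x)
    (hY : MDiffAt (T% Y) x) (hW : MDiffAt (T% W) x) :
    koszul I (c • U) Y W x = c * koszul I U Y W x := by
  have : CompleteSpace E := FiniteDimensional.complete ℝ E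
  have h1 : mvfderiv I (fun y => c * inner ℝ (U y) (W y)) x = c • mvfderiv I (fun y => inner ℝ (U y) (W y)) x := by
    rw [mvfderiv_fun_mul mdifferentiableAt_const (inner_mdiff hU hW), mvfderiv_const]; simp
  have h2 : mvfderiv I (fun y => c * inner ℝ (U y) (Y y)) x = c • mvfderiv I (fun y => inner ℝ (U y) (Y y)) x := by
    rw [mvfderiv_fun_mul mdifferentiableAt_const (inner_mdiff hU hY), mvfderiv_const]; simp
  simp only [koszul, Pi.smul_apply, real_inner_smul_left, real_inner_smul_right, map_smul, h1, h2,
    mlieBracket_const_smul_left hU, smul_apply, smul_eq_mul]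
  ring

theorem koszul_add_right (hU : MDiffAt (T% U) x) (hY : MDiffAt (T% Y) x)
    (hW : MDiffAt (T% W) x) (hW' : MDiffAt (T% W') x) :
    koszul I U Y (W + W') x = koszul I U Y W x + koszul I U Y W' x := by
  have : CompleteSpace E := FiniteDimensional.complete ℝ E
  simp only [koszul, Pi.add_apply, inner_add_left, inner_add_right, map_add,
    mlieBracket_add_right hW hW', mvfderiv_fun_add (inner_mdiff hU hW) (inner_mdiff hU hW'),
    mvfderiv_fun_add (inner_mdiff hY hW) (inner_mdiff hY hW'), add_apply]
  ring

theorem koszul_smul_right (c : ℝ) (hU : MDiffAt (T% U) x)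
    (hY : MDiffAt (T% Y) x) (hW : MDiffAt (T% W) x) :
    koszul I U Y (c • W) x = c * koszul I U Y W x := by
  have : CompleteSpace E := FiniteDimensional.complete ℝ E
  have h1 : mvfderiv I (fun y => c * inner ℝ (U y) (W y)) x = c • mvfderiv I (fun y => inner ℝ (U y) (W y)) x := by
    rw [mvfderiv_fun_mul mdifferentiableAt_const (inner_mdiff hU hW), mvfderiv_const]; simp
  have h2 : mvfderiv I (fun y => c * inner ℝ (Y y) (W y)) x = c • mvfderiv I (fun y => inner ℝ (Y y) (W y)) x := by
    rw [mvfderiv_fun_mul mdifferentiableAt_const (inner_mdiff hY hW), mvfderiv_const]; simp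
  simp only [koszul, Pi.smul_apply, real_inner_smul_left, real_inner_smul_right, map_smul, h1, h2,
    mlieBracket_const_smul_right hW, smul_apply, smul_eq_mul]
  ring

theorem koszul_add_mid (hU : MDiffAt (T% U) x) (hY : MDiffAt (T% Y) x)
    (hY' : MDiffAt (T% Y') x) (hW : MDiffAt (T% W) x) :
    koszul I U (Y + Y') W x = koszul I U Y W x + koszul I U Y' W x := by
  have : CompleteSpace E := FiniteDimensional.complete ℝ E
  simp only [koszul, Pi.add_apply, inner_add_left, inner_add_right, map_add,
    mlieBracket_add_right hY hY', mlieBracket_add_left hY hY',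
    mvfderiv_fun_add (inner_mdiff hY hW) (inner_mdiff hY' hW),
    mvfderiv_fun_add (inner_mdiff hU hY) (inner_mdiff hU hY'), add_apply]
  ring

theorem koszul_smul_mid {f : M → ℝ} (hf : MDiffAt f x) (hU : MDiffAt (T% U) x)
    (hY : MDiffAt (T% Y) x) (hW : MDiffAt (T% W) x) :
    koszul I U (f • Y) W x =
      f x * koszul I U Y W x + mvfderiv I f x (U x) * inner ℝ (Y x) (W x) := by
  have : CompleteSpace E := FiniteDimensional.complete ℝ E
  simp only [koszul, Pi.smul_apply', real_inner_smul_left, real_inner_smul_right, map_smul,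
    mvfderiv_fun_mul hf (inner_mdiff hU hY), mvfderiv_fun_mul hf (inner_mdiff hY hW),
    mlieBracket_smul_right hf hY, mlieBracket_smul_left hf hY,
    smul_apply, add_apply, smul_eq_mul, inner_add_left]
  rw [real_inner_comm (U x) (Y x)]
  ring

/-- The vector field `Y` and `u : T_x M` give the functional `w ↦ ⟨∇_u Y, w⟩` -/
def koszulForm (Y : Π x : M, TangentSpace I x) (x : M) (hY : MDiffAt (T% Y) x) :
    TangentSpace I x →ₗ[ℝ] TangentSpace I x →ₗ[ℝ] ℝ :=
  LinearMap.mk₂ ℝ (fun u w => koszul I (extendField u) Y (extendField w) x)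
    (fun u u' w => by
      rw [extendField_add]; apply koszul_add_left <;> first | exact hY | apply mdifferentiableAt_extendField)
    (fun c u w => by
      rw [extendField_smul]; apply koszul_smul_left <;> first | exact hY | apply mdifferentiableAt_extendField)
    (fun u w w' => by
      rw [extendField_add]; apply koszul_add_right <;> first | exact hY | apply mdifferentiableAt_extendField)
    (fun c u w => by
      rw [extendField_smul]; apply koszul_smul_right <;> first | exact hY | apply mdifferentiableAt_extendField)

/-- The Riesz isomorphism between linear forms on `T_xM` and tangent vectors. -/
def rieszL (x : M) : (TangentSpace I x →ₗ[ℝ] ℝ) →ₗ[ℝ] TangentSpace I x :=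
  have : CompleteSpace (TangentSpace I x) := FiniteDimensional.complete ℝ _
  (InnerProductSpace.toDual ℝ (TangentSpace I x)).symm.toLinearEquiv.toLinearMap ∘ₗ
    LinearMap.toContinuousLinearMap.toLinearMap

theorem inner_rieszL (x : M) (l : TangentSpace I x →ₗ[ℝ] ℝ) (w : TangentSpace I x) :
    inner ℝ (rieszL x l) w = l w := by
  have : CompleteSpace (TangentSpace I x) := FiniteDimensional.complete ℝ _
  simp [rieszL]

open Classical in
/-- The covariant derivative `u ↦ ∇_u Y` at `x` given by the Koszul formula (zero if `Y` is not
differentiable at `x`). -/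
def leviCivitaFun (Y : Π x : M, TangentSpace I x) (x : M) :
    TangentSpace I x →L[ℝ] TangentSpace I x :=
  if hY : MDiffAt (T% Y) x then LinearMap.toContinuousLinearMap (rieszL x ∘ₗ koszulForm Y x hY)
  else 0

theorem inner_leviCivitaFun (hY : MDiffAt (T% Y) x) (u w : TangentSpace I x) :
    inner ℝ (leviCivitaFun Y x u) w = koszul I (extendField u) Y (extendField w) x := by
  simp [leviCivitaFun, hY, inner_rieszL, koszulForm]

variable (I M) in
/-- The Levi-Civita connection of the Riemannian manifold `M`; it is metric and torsion-free by the
two theorems below. -/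
def leviCivita : CovariantDerivative I E (fun x : M => TangentSpace I x) where
  toFun := leviCivitaFun
  isCovariantDerivativeOnUniv :=
    { add := by
        intro Y Y' x hY hY' _
        ext u
        refine ext_inner_right ℝ fun w => ?_
        have h := mdifferentiableAt_add_section hY hY'
        rw [add_apply, inner_add_left, inner_leviCivitaFun hY,
          inner_leviCivitaFun hY', inner_leviCivitaFun h]
        exact koszul_add_mid (mdifferentiableAt_extendField u) hY hY' (mdifferentiableAt_extendField w)
      leibniz := by
        intro Y f x hY hf _
        ext u
        refine ext_inner_right ℝ fun w => ?_
        have h := hf.smul_section hY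
        rw [add_apply, inner_add_left, inner_leviCivitaFun h,
          smul_apply, real_inner_smul_left, inner_leviCivitaFun hY,
          koszul_smul_mid hf (mdifferentiableAt_extendField u) hY (mdifferentiableAt_extendField w)]
        simp [real_inner_smul_left] }

theorem leviCivita_isMetricCompatible :
    CovariantDerivative.IsMetricCompatible (V := fun x : M => TangentSpace I x) (F := E)
      (leviCivita I M) := by
  unfold CovariantDerivative.IsMetricCompatible
  ext x s t u
  have hs := mdifferentiableAt_extendField s
  have ht := mdifferentiableAt_extendField t
  have h := CovariantDerivative.derivMetricTensor_apply (V := fun x : M => TangentSpace I x)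
    (F := E) (leviCivita I M) x (X := extendField u) hs ht
  simp only [extendField_self] at h
  rw [h]
  change _ - inner ℝ (leviCivitaFun _ x u) t - inner ℝ s (leviCivitaFun _ x u) = 0
  rw [real_inner_comm _ s, inner_leviCivitaFun hs, inner_leviCivitaFun ht]
  simp only [koszul, extendField_self]
  rw [mlieBracket_swap_apply (V := extendField t) (W := extendField s)]
  simp only [real_inner_comm (extendField t _) (extendField s _), inner_neg_left]
  ring

theorem leviCivita_torsion [CompleteSpace E] : (leviCivita I M).torsion = 0 := by
  ext x u v
  have hu := mdifferentiableAt_extendField u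
  have hv := mdifferentiableAt_extendField v
  have h := (leviCivita I M).torsion_apply hu hv
  simp only [extendField_self] at h
  rw [h]
  refine ext_inner_right ℝ fun w => ?_
  change inner ℝ (leviCivitaFun _ x _ - leviCivitaFun _ x _ - _) w = inner ℝ 0 w
  rw [inner_sub_left, inner_sub_left, inner_leviCivitaFun hv, inner_leviCivitaFun hu]
  simp only [koszul, extendField_self, inner_zero_left]
  rw [mlieBracket_swap_apply (V := extendField v) (W := extendField u)]
  simp only [real_inner_comm (extendField v _) (extendField u _), inner_neg_left]
  ring
end LC

section CurvatureBundle
variable {E : Type*} [NormedAddCommGroup E] [NormedSpace ℝ E] [FiniteDimensional ℝ E]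
  {H : Type*} [TopologicalSpace H] {I : ModelWithCorners ℝ E H}
  {M : Type*} [TopologicalSpace M] [ChartedSpace H M] [IsManifold I ∞ M]
  [RiemannianBundle (fun x : M => TangentSpace I x)]
  [IsContMDiffRiemannianBundle I ∞ E (fun x : M => TangentSpace I x)]

/-- The endomorphism `u ↦ ∇_v U` of `T_xM`, where `U` is the field that extends `u` with constant
coordinates in the trivialization around `x` and `∇` is the Levi-Civita connection. -/
def christoffelEnd (x : M) (v : TangentSpace I x) : TangentSpace I x →L[ℝ] TangentSpace I x :=
  LinearMap.toContinuousLinearMap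
    { toFun := fun u => leviCivita I M (extendField u) x v
      map_add' := fun u u' => by
        rw [extendField_add, (leviCivita I M).isCovariantDerivativeOnUniv.add
          (mdifferentiableAt_extendField u) (mdifferentiableAt_extendField u')]
        rfl
      map_smul' := fun c u => by
        rw [extendField_smul, (leviCivita I M).isCovariantDerivativeOnUniv.smul_const c
          (mdifferentiableAt_extendField u)]
        rfl }

/-- The section `R` of the bundle of algebraic curvature tensors is smooth: around each point `x`,
it is smooth when it is read in the trivialization of the tangent bundle around `x`. -/
def IsSmoothCurvSection (R : Π x : M, AlgCurv (TangentSpace I x)) : Prop :=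
  ∀ x : M, ContMDiffAt I 𝓘(ℝ, AlgCurv (TangentSpace I x)) ∞
    (fun y => (R y).pullback (tangentTransition x y)) x

/-- The covariant derivative `∇_v R` at `x` of a section `R` of the bundle of algebraic curvature
tensors, by the product rule:
`(∇_v R)(u₁, …, u₄) = v(R(U₁, …, U₄)) - ∑ a, R(u₁, …, ∇_v U_a, …, u₄)`,
where `U_a` extends `u_a` with constant coordinates in the trivialization around `x`. -/
def covDeriv (R : Π x : M, AlgCurv (TangentSpace I x)) (x : M) (v : TangentSpace I x) :
    AlgCurv (TangentSpace I x) :=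
  mvfderiv I (fun y => (R y).pullback (tangentTransition x y)) x v
    - (R x).act (christoffelEnd x v)

/-- The Laplacian `ΔR = tr ∇²R`, the sum of the second covariant derivatives
`∇²_{e,e} R = ∇_e (∇_e R) - ∇_{∇_e e} R` over an orthonormal basis of `T_xM`. -/
def connLaplacian (R : Π x : M, AlgCurv (TangentSpace I x)) (x : M) :
    AlgCurv (TangentSpace I x) :=
  ∑ i, (covDeriv (fun y => covDeriv R y (extendField (stdOrthonormalBasis ℝ (TangentSpace I x) i) y))
      x (stdOrthonormalBasis ℝ (TangentSpace I x) i)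
    - covDeriv R x (leviCivita I M (extendField (stdOrthonormalBasis ℝ (TangentSpace I x) i)) x
        (stdOrthonormalBasis ℝ (TangentSpace I x) i)))

/-- The velocity of a curve in `M`. -/
def velocity (I : ModelWithCorners ℝ E H) (γ : ℝ → M) (t : ℝ) : TangentSpace I (γ t) :=
  mfderiv 𝓘(ℝ, ℝ) I γ t (1 : ℝ)

/-- The field `A` of algebraic curvature tensors along the curve `γ` satisfies `(∇/dt) A = 0` at
the time `t`: by the product rule, for all vector fields `X`, `Y`, `Z`, `W` on `M`,
`d/dt A(X, Y, Z, W)` is the sum of the four terms in which one of the fields is replaced by its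
covariant derivative along `γ`. -/
def IsParallelAt (γ : ℝ → M) (A : Π t : ℝ, AlgCurv (TangentSpace I (γ t))) (t : ℝ) : Prop :=
  ∀ X Y Z W : Π y : M, TangentSpace I y,
    MDiffAt (T% X) (γ t) → MDiffAt (T% Y) (γ t) → MDiffAt (T% Z) (γ t) → MDiffAt (T% W) (γ t) →
    HasDerivAt (fun s => (A s).eval (X (γ s)) (Y (γ s)) (Z (γ s)) (W (γ s)))
      ((A t).eval (leviCivita I M X (γ t) (velocity I γ t)) (Y (γ t)) (Z (γ t)) (W (γ t))
        + (A t).eval (X (γ t)) (leviCivita I M Y (γ t) (velocity I γ t)) (Z (γ t)) (W (γ t))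
        + (A t).eval (X (γ t)) (Y (γ t)) (leviCivita I M Z (γ t) (velocity I γ t)) (W (γ t))
        + (A t).eval (X (γ t)) (Y (γ t)) (Z (γ t)) (leviCivita I M W (γ t) (velocity I γ t))) t

/-- The subset `C` of the bundle of algebraic curvature tensors is invariant under parallel
transport along smooth curves with respect to the Levi-Civita connection. -/
def IsParallelInvariant (C : ∀ x : M, Set (AlgCurv (TangentSpace I x))) : Prop :=
  ∀ (γ : ℝ → M) (A : Π t : ℝ, AlgCurv (TangentSpace I (γ t))) (a b : ℝ),
    (∀ t ∈ uIcc a b, ContMDiffAt 𝓘(ℝ, ℝ) I ∞ γ t) → (∀ t ∈ uIcc a b, IsParallelAt γ A t) →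
    A a ∈ C (γ a) → A b ∈ C (γ b)

/-- The linear map `T_yM → T_xM` given by the trivialization of the tangent bundle around `x`,
inverse to `tangentTransition x y` for `y` in the domain of that trivialization. -/
def tangentTransitionBack (x y : M) : TangentSpace I y →L[ℝ] TangentSpace I x :=
  ((trivializationAt E (TangentSpace I) x).symmL ℝ x).comp
    ((trivializationAt E (TangentSpace I) x).continuousLinearMapAt ℝ y)

/-- The subset `C` of the (total space of the) bundle of algebraic curvature tensors is closed:
for all `x`, it is closed in the local trivialization, over an open neighbourhood of `x` and with
fibre the algebraic curvature tensors on `T_xM`, induced by the one of the tangent bundle. -/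
def IsClosedInCurvBundle (C : ∀ x : M, Set (AlgCurv (TangentSpace I x))) : Prop :=
  ∀ x : M, IsClosed {p : (trivializationAt E (TangentSpace I) x).baseSet × AlgCurv (TangentSpace I x) |
    p.2.pullback (tangentTransitionBack x (p.1 : M)) ∈ C p.1}

end CurvatureBundle

end

open Bundle
open scoped Manifold ContDiff

set_option linter.unusedSectionVars false

/-! Fix a tangent vector `e` at `x`, put `E = extendField e`, and let `γ` be the curve through `x`
with velocity `e` that is a straight line in the chart around `x`. Parallel transport of `R(γ t)`
back to `x` gives a curve `r` in the fixed vector space of curvature tensors on `T_xM`. Since `C` is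
parallel, `r` stays in `C x`, and `r 0 = R x` lies on `N`. Since `γ` is an integral curve of `E`,
the derivative of `r` is the transported section `∇_E R`. Hence `r'(0) = ∇_e R` and `r''(0) = ∇_e
(∇_E R)`.

Near `R x` the set `C x` lies in `{f ≤ 0}`, where `f` is a defining function of `N` whose gradient
is a positive multiple of `ν` (`IsSupportingHypersurface.eventually_nonpos`). So `f ∘ r` has a local
maximum at `0`. Its first derivative vanishes, which says that `∇_e R` is tangent to `N`. Its second
derivative `D²f(r', r') + Df(r'')` is nonpositive. On tangent vectors `D²f` is `-‖grad f‖` times the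
second fundamental form (`secondFundamentalForm_eq`), so `⟨∇_e (∇_E R), ν⟩ ≤ II(∇_e R, ∇_e R)`. This
is `IsSupportingHypersurface.second_variation`, applied in
`IsSupportingHypersurface.covDeriv_covDeriv`.

The Laplacian also contains the terms `∇_{∇_e E} R`. By the first order condition they are
orthogonal to `ν`, so chart lines serve as well as geodesics. The remaining sum is the trace of a
bilinear form and may be computed in the basis `b`. The tuple `(∇_{b_i} R)` is tangent to `N` and
satisfies the second Bianchi identity, so the bound on `N` finishes the proof.

Parallel transport is made explicit by a matrix solution of `W' = W Γ`, where `Γ` are the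
Christoffel symbols in the trivialization around `x`. This requires `Γ` to be `C¹`
(`contMDiffAt_frameChristoffel`) and requires `∇R`, which is defined at each point through the
trivialization around that point, to be read in one fixed trivialization (`pullback_covDeriv`). -/

namespace AlgCurv

/-! ### Evaluation and multilinearity of algebraic curvature tensors -/

section
variable {V : Type*} [NormedAddCommGroup V] [InnerProductSpace ℝ V]

theorem ext_eval {R S : AlgCurv V} (h : ∀ u v w z, R.eval u v w z = S.eval u v w z) : R = S := by
  refine Subtype.ext (MultilinearMap.ext fun m => ?_)
  have e : m = ![m 0, m 1, m 2, m 3] := by ext a; fin_cases a <;> rfl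
  rw [e]
  exact h _ _ _ _

theorem eval_add (R S : AlgCurv V) (u v w z : V) :
    (R + S).eval u v w z = R.eval u v w z + S.eval u v w z := rfl

theorem eval_sub (R S : AlgCurv V) (u v w z : V) :
    (R - S).eval u v w z = R.eval u v w z - S.eval u v w z := rfl

theorem eval_smul (c : ℝ) (R : AlgCurv V) (u v w z : V) :
    (c • R).eval u v w z = c * R.eval u v w z := rfl

theorem eval_pullback {W : Type*} [NormedAddCommGroup W] [InnerProductSpace ℝ W]
    (P : V →L[ℝ] W) (R : AlgCurv W) (u v w z : V) :
    (R.pullback P).eval u v w z = R.eval (P u) (P v) (P w) (P z) := by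
  simp only [eval, pullback, MultilinearMap.compLinearMap_apply]
  congr 1
  ext a
  fin_cases a <;> rfl

theorem eval_act (A : V →L[ℝ] V) (R : AlgCurv V) (u v w z : V) :
    (R.act A).eval u v w z = R.eval (A u) v w z + R.eval u (A v) w z + R.eval u v (A w) z
      + R.eval u v w (A z) := by
  change (∑ a : Fin 4, R.1.compLinearMap (Function.update (fun _ => LinearMap.id) a A.toLinearMap))
    ![u, v, w, z] = _
  rw [sum_apply, Fin.sum_univ_four]
  simp only [MultilinearMap.compLinearMap_apply]
  congr 1
  · congr 1
    · congr 1 <;> (simp only [eval]; congr 1; ext a; fin_cases a <;> rfl)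
    · simp only [eval]; congr 1; ext a; fin_cases a <;> rfl
  · simp only [eval]; congr 1; ext a; fin_cases a <;> rfl

theorem pullback_id (R : AlgCurv V) : R.pullback (ContinuousLinearMap.id ℝ V) = R :=
  ext_eval fun u v w z => by simp only [eval_pullback, ContinuousLinearMap.id_apply]

theorem eval_add₁ (R : AlgCurv V) (u u' v w z : V) :
    R.eval (u + u') v w z = R.eval u v w z + R.eval u' v w z := by
  have e (x : V) : Function.update ![u, v, w, z] 0 x = ![x, v, w, z] := by
    ext a; fin_cases a <;> rfl
  have h := R.1.map_update_add ![u, v, w, z] 0 u u'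
  simp only [e] at h
  exact h

theorem eval_add₂ (R : AlgCurv V) (u v v' w z : V) :
    R.eval u (v + v') w z = R.eval u v w z + R.eval u v' w z := by
  have e (x : V) : Function.update ![u, v, w, z] 1 x = ![u, x, w, z] := by
    ext a; fin_cases a <;> rfl
  have h := R.1.map_update_add ![u, v, w, z] 1 v v'
  simp only [e] at h
  exact h

theorem eval_add₃ (R : AlgCurv V) (u v w w' z : V) :
    R.eval u v (w + w') z = R.eval u v w z + R.eval u v w' z := by
  have e (x : V) : Function.update ![u, v, w, z] 2 x = ![u, v, x, z] := by
    ext a; fin_cases a <;> rfl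
  have h := R.1.map_update_add ![u, v, w, z] 2 w w'
  simp only [e] at h
  exact h

theorem eval_add₄ (R : AlgCurv V) (u v w z z' : V) :
    R.eval u v w (z + z') = R.eval u v w z + R.eval u v w z' := by
  have e (x : V) : Function.update ![u, v, w, z] 3 x = ![u, v, w, x] := by
    ext a; fin_cases a <;> rfl
  have h := R.1.map_update_add ![u, v, w, z] 3 z z'
  simp only [e] at h
  exact h

theorem eval_smul₁ (R : AlgCurv V) (c : ℝ) (u v w z : V) :
    R.eval (c • u) v w z = c * R.eval u v w z := by
  have e (x : V) : Function.update ![u, v, w, z] 0 x = ![x, v, w, z] := by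
    ext a; fin_cases a <;> rfl
  have h := R.1.map_update_smul ![u, v, w, z] 0 c u
  simp only [e] at h
  exact h

theorem eval_smul₂ (R : AlgCurv V) (c : ℝ) (u v w z : V) :
    R.eval u (c • v) w z = c * R.eval u v w z := by
  have e (x : V) : Function.update ![u, v, w, z] 1 x = ![u, x, w, z] := by
    ext a; fin_cases a <;> rfl
  have h := R.1.map_update_smul ![u, v, w, z] 1 c v
  simp only [e] at h
  exact h

theorem eval_smul₃ (R : AlgCurv V) (c : ℝ) (u v w z : V) :
    R.eval u v (c • w) z = c * R.eval u v w z := by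
  have e (x : V) : Function.update ![u, v, w, z] 2 x = ![u, v, x, z] := by
    ext a; fin_cases a <;> rfl
  have h := R.1.map_update_smul ![u, v, w, z] 2 c w
  simp only [e] at h
  exact h

theorem eval_smul₄ (R : AlgCurv V) (c : ℝ) (u v w z : V) :
    R.eval u v w (c • z) = c * R.eval u v w z := by
  have e (x : V) : Function.update ![u, v, w, z] 3 x = ![u, v, w, x] := by
    ext a; fin_cases a <;> rfl
  have h := R.1.map_update_smul ![u, v, w, z] 3 c z
  simp only [e] at h
  exact h

theorem eval_neg₁ (R : AlgCurv V) (u v w z : V) : R.eval (-u) v w z = -R.eval u v w z := by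
  simpa using R.eval_smul₁ (-1) u v w z

theorem eval_neg₂ (R : AlgCurv V) (u v w z : V) : R.eval u (-v) w z = -R.eval u v w z := by
  simpa using R.eval_smul₂ (-1) u v w z

theorem eval_neg₃ (R : AlgCurv V) (u v w z : V) : R.eval u v (-w) z = -R.eval u v w z := by
  simpa using R.eval_smul₃ (-1) u v w z

theorem eval_neg₄ (R : AlgCurv V) (u v w z : V) : R.eval u v w (-z) = -R.eval u v w z := by
  simpa using R.eval_smul₄ (-1) u v w z

/-- An algebraic curvature tensor as a linear form in its first argument. -/
noncomputable def evalₗ₁ (R : AlgCurv V) (v w z : V) : V →ₗ[ℝ] ℝ :=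
  ⟨⟨fun u => R.eval u v w z, fun u u' => R.eval_add₁ u u' v w z⟩, fun c u => R.eval_smul₁ c u v w z⟩

/-- An algebraic curvature tensor as a linear form in its second argument. -/
noncomputable def evalₗ₂ (R : AlgCurv V) (u w z : V) : V →ₗ[ℝ] ℝ :=
  ⟨⟨fun v => R.eval u v w z, fun v v' => R.eval_add₂ u v v' w z⟩, fun c v => R.eval_smul₂ c u v w z⟩

/-- An algebraic curvature tensor as a linear form in its third argument. -/
noncomputable def evalₗ₃ (R : AlgCurv V) (u v z : V) : V →ₗ[ℝ] ℝ :=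
  ⟨⟨fun w => R.eval u v w z, fun w w' => R.eval_add₃ u v w w' z⟩, fun c w => R.eval_smul₃ c u v w z⟩

/-- An algebraic curvature tensor as a linear form in its fourth argument. -/
noncomputable def evalₗ₄ (R : AlgCurv V) (u v w : V) : V →ₗ[ℝ] ℝ :=
  ⟨⟨fun z => R.eval u v w z, fun z z' => R.eval_add₄ u v w z z'⟩, fun c z => R.eval_smul₄ c u v w z⟩

theorem act_add_right (A : V →L[ℝ] V) (R S : AlgCurv V) :
    (R + S).act A = R.act A + S.act A :=
  ext_eval fun u v w z => by
    simp only [eval_act, eval_add]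
    ring

theorem act_smul_right (A : V →L[ℝ] V) (c : ℝ) (R : AlgCurv V) :
    (c • R).act A = c • R.act A :=
  ext_eval fun u v w z => by
    simp only [eval_act, eval_smul]
    ring

theorem act_add_left (A B : V →L[ℝ] V) (R : AlgCurv V) :
    R.act (A + B) = R.act A + R.act B :=
  ext_eval fun u v w z => by
    simp only [eval_act, eval_add, add_apply, eval_add₁, eval_add₂, eval_add₃, eval_add₄]
    ring

theorem act_smul_left (c : ℝ) (A : V →L[ℝ] V) (R : AlgCurv V) :
    R.act (c • A) = c • R.act A :=
  ext_eval fun u v w z => by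
    simp only [eval_act, eval_smul, smul_apply, eval_smul₁, eval_smul₂, eval_smul₃, eval_smul₄]
    ring

end

/-! ### Differentiation of curves of algebraic curvature tensors -/

section Calculus
variable {V : Type*} [NormedAddCommGroup V] [InnerProductSpace ℝ V] [FiniteDimensional ℝ V]

set_option maxSynthPendingDepth 3 in
set_option synthInstance.maxHeartbeats 200000 in
/-- The action of endomorphisms on algebraic curvature tensors as a continuous bilinear map. -/
noncomputable def actL (V : Type*) [NormedAddCommGroup V] [InnerProductSpace ℝ V]
    [FiniteDimensional ℝ V] : (V →L[ℝ] V) →L[ℝ] AlgCurv V →L[ℝ] AlgCurv V :=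
  let L (A : V →L[ℝ] V) : AlgCurv V →L[ℝ] AlgCurv V := LinearMap.toContinuousLinearMap
    ⟨⟨fun R => R.act A, act_add_right A⟩, act_smul_right A⟩
  LinearMap.toContinuousLinearMap
    ⟨⟨L, fun A B => by ext R; exact act_add_left A B R⟩,
      fun c A => by ext R; exact act_smul_left c A R⟩

-- In finite dimension, differentiability of the forms on each fixed vector suffices: expand `Y` in
-- an orthonormal basis and apply the product rule to each summand. It yields the product rule for
-- curvature tensors one slot at a time.
set_option maxSynthPendingDepth 3 in
set_option synthInstance.maxHeartbeats 200000 in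
theorem hasDerivAt_linearMap_apply {g : ℝ → V →ₗ[ℝ] ℝ} {g' : V →ₗ[ℝ] ℝ} {Y : ℝ → V} {Y' : V}
    {t : ℝ} (hg : ∀ v, HasDerivAt (fun s => g s v) (g' v) t) (hY : HasDerivAt Y Y' t) :
    HasDerivAt (fun s => g s (Y s)) (g' (Y t) + g t Y') t := by
  let b := stdOrthonormalBasis ℝ V
  have e (l : V →ₗ[ℝ] ℝ) (v : V) : l v = ∑ i, inner ℝ (b i) v * l (b i) := by
    conv_lhs => rw [← b.sum_repr' v]
    simp
  have hi (i) : HasDerivAt (fun s => inner ℝ (b i) (Y s)) (inner ℝ (b i) Y') t := by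
    simpa using (hasDerivAt_const t (b i)).inner ℝ hY
  have h := HasDerivAt.fun_sum (u := Finset.univ) fun i _ => (hi i).mul (hg (b i))
  refine (h.congr_of_eventuallyEq (Eventually.of_forall fun s => ?_)).congr_deriv ?_
  · exact e _ _
  · rw [Finset.sum_add_distrib, ← e, ← e, add_comm]

theorem hasDerivAt_eval_const {R : ℝ → AlgCurv V} {R' : AlgCurv V} {t : ℝ}
    (hR : HasDerivAt R R' t) (u v w z : V) :
    HasDerivAt (fun s => (R s).eval u v w z) (R'.eval u v w z) t := by
  let l : AlgCurv V →ₗ[ℝ] ℝ := ⟨⟨fun R => R.eval u v w z, fun R S => rfl⟩, fun c R => rfl⟩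
  exact (LinearMap.toContinuousLinearMap l).hasFDerivAt.comp_hasDerivAt t hR

theorem hasDerivAt_eval {R : ℝ → AlgCurv V} {X Y Z W : ℝ → V} {R' : AlgCurv V} {X' Y' Z' W' : V}
    {t : ℝ} (hR : HasDerivAt R R' t) (hX : HasDerivAt X X' t) (hY : HasDerivAt Y Y' t)
    (hZ : HasDerivAt Z Z' t) (hW : HasDerivAt W W' t) :
    HasDerivAt (fun s => (R s).eval (X s) (Y s) (Z s) (W s))
      (R'.eval (X t) (Y t) (Z t) (W t) + ((R t).eval X' (Y t) (Z t) (W t)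
        + (R t).eval (X t) Y' (Z t) (W t) + (R t).eval (X t) (Y t) Z' (W t)
        + (R t).eval (X t) (Y t) (Z t) W')) t := by
  have h1 (v w z : V) : HasDerivAt (fun s => (R s).eval (X s) v w z)
      (R'.eval (X t) v w z + (R t).eval X' v w z) t :=
    hasDerivAt_linearMap_apply (g := fun s => (R s).evalₗ₁ v w z) (g' := R'.evalₗ₁ v w z)
      (fun u => hasDerivAt_eval_const hR u v w z) hX
  have h2 (w z : V) : HasDerivAt (fun s => (R s).eval (X s) (Y s) w z)
      (R'.eval (X t) (Y t) w z + (R t).eval X' (Y t) w z + (R t).eval (X t) Y' w z) t :=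
    hasDerivAt_linearMap_apply (g := fun s => (R s).evalₗ₂ (X s) w z)
      (g' := R'.evalₗ₂ (X t) w z + (R t).evalₗ₂ X' w z) (fun v => h1 v w z) hY
  have h3 (z : V) : HasDerivAt (fun s => (R s).eval (X s) (Y s) (Z s) z)
      (R'.eval (X t) (Y t) (Z t) z + (R t).eval X' (Y t) (Z t) z + (R t).eval (X t) Y' (Z t) z
        + (R t).eval (X t) (Y t) Z' z) t :=
    hasDerivAt_linearMap_apply (g := fun s => (R s).evalₗ₃ (X s) (Y s) z)
      (g' := R'.evalₗ₃ (X t) (Y t) z + (R t).evalₗ₃ X' (Y t) z + (R t).evalₗ₃ (X t) Y' z)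
      (fun w => h2 w z) hZ
  have h4 : HasDerivAt (fun s => (R s).eval (X s) (Y s) (Z s) (W s))
      (R'.eval (X t) (Y t) (Z t) (W t) + (R t).eval X' (Y t) (Z t) (W t)
        + (R t).eval (X t) Y' (Z t) (W t) + (R t).eval (X t) (Y t) Z' (W t)
        + (R t).eval (X t) (Y t) (Z t) W') t :=
    hasDerivAt_linearMap_apply (g := fun s => (R s).evalₗ₄ (X s) (Y s) (Z s))
      (g' := R'.evalₗ₄ (X t) (Y t) (Z t) + (R t).evalₗ₄ X' (Y t) (Z t)
        + (R t).evalₗ₄ (X t) Y' (Z t) + (R t).evalₗ₄ (X t) (Y t) Z') (fun z => h3 z) hW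
  exact h4.congr_deriv (by ring)

/-- The values on basis vectors determine a curvature tensor, so they form an injective linear map.
Its linear left inverse, continuous by finite dimension, carries differentiability of the values
back to the tensor. -/
theorem hasDerivAt_of_eval {R : ℝ → AlgCurv V} {R' : AlgCurv V} {t : ℝ}
    (h : ∀ u v w z, HasDerivAt (fun s => (R s).eval u v w z) (R'.eval u v w z) t) :
    HasDerivAt R R' t := by
  let b := stdOrthonormalBasis ℝ V
  let F : AlgCurv V →ₗ[ℝ] ((Fin 4 → Fin (Module.finrank ℝ V)) → ℝ) :=
    ⟨⟨fun R f => R.eval (b (f 0)) (b (f 1)) (b (f 2)) (b (f 3)), fun R S => rfl⟩, fun c R => rfl⟩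
  have hF : LinearMap.ker F = ⊥ := by
    refine LinearMap.ker_eq_bot'.2 fun R hR => ?_
    refine Subtype.ext (Module.Basis.ext_multilinear (fun _ => b.toBasis) fun f => ?_)
    have := congrFun hR f
    simp only [OrthonormalBasis.coe_toBasis]
    refine Eq.trans ?_ this
    change R.1 _ = R.1 _
    congr 1
    ext a
    fin_cases a <;> rfl
  clear_value b
  obtain ⟨G, hG⟩ := F.exists_leftInverse_of_injective hF
  have hF' : HasDerivAt (fun s => F (R s)) (F R') t :=
    hasDerivAt_pi.2 fun f => h _ _ _ _
  have := (LinearMap.toContinuousLinearMap G).hasFDerivAt.comp_hasDerivAt t (f := fun s => F (R s)) hF'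
  have hGF (S : AlgCurv V) : G (F S) = S := LinearMap.congr_fun hG S
  simpa [Function.comp_def, hGF] using this

end Calculus
end AlgCurv

/-! ### Supporting hypersurfaces, second fundamental form and second variation -/

section
variable {W : Type*} [NormedAddCommGroup W] [InnerProductSpace ℝ W]

/-- Moving along a direction in which the derivative of `f` is positive, the values of `f`
increase, uniformly near a given point. -/
theorem exists_ball_strictMonoOn_line {f : W → ℝ} {V : Set W} (hV : IsOpen V) {p v : W}
    (hp : p ∈ V) (hf : ContDiffOn ℝ ∞ f V) (hv : 0 < fderiv ℝ f p v) :
    ∃ r > 0, Metric.ball p r ⊆ V ∧ ∀ (q : W) (s : ℝ), 0 < s → (∀ t ∈ Icc 0 s, q + t • v ∈ Metric.ball p r) →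
      f q < f (q + s • v) := by
  have hcont : ContinuousAt (fun q => fderiv ℝ f q v) p := by
    have h1 : ContinuousOn (fderiv ℝ f) V := hf.continuousOn_fderiv_of_isOpen hV (by simp)
    exact (h1.continuousAt (hV.mem_nhds hp)).clm_apply continuousAt_const
  have hev : ∀ᶠ q in 𝓝 p, q ∈ V ∧ 0 < fderiv ℝ f q v :=
    (hV.eventually_mem hp).and (hcont.eventually (lt_mem_nhds hv))
  obtain ⟨r, hr, hball⟩ := Metric.eventually_nhds_iff_ball.1 hev
  refine ⟨r, hr, fun q hq => (hball q hq).1, fun q s hs hq => ?_⟩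
  have hd (t : ℝ) (ht : t ∈ Icc 0 s) :
      HasDerivAt (fun t : ℝ => f (q + t • v)) (fderiv ℝ f (q + t • v) v) t := by
    have h1 : HasFDerivAt f (fderiv ℝ f (q + t • v)) (q + t • v) :=
      ((hf.differentiableOn (by simp)).differentiableAt
        (hV.mem_nhds (hball _ (hq t ht)).1)).hasFDerivAt
    have h2 : HasDerivAt (fun t : ℝ => q + t • v) v t := by
      simpa using ((hasDerivAt_id t).smul_const v).const_add q
    exact h1.comp_hasDerivAt t h2
  have hmono : StrictMonoOn (fun t : ℝ => f (q + t • v)) (Icc 0 s) := by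
    refine strictMonoOn_of_deriv_pos (convex_Icc 0 s)
      (fun t ht => (hd t ht).continuousAt.continuousWithinAt) fun t ht => ?_
    rw [interior_Icc] at ht
    rw [(hd t (Ioo_subset_Icc_self ht)).deriv]
    exact (hball _ (hq t (Ioo_subset_Icc_self ht))).2
  simpa using hmono (left_mem_Icc.2 hs.le) (right_mem_Icc.2 hs.le) hs

/-- Near `p`, a set supported by the hypersurface `{f = 0}` is contained in `{f ≤ 0}`. -/
theorem IsSupportingHypersurface.eventually_nonpos {C N : Set W} {ν : W → W} {p : W}
    (h : IsSupportingHypersurface C N ν p) {V : Set W} (hV : IsOpen V) (hp : p ∈ V) {f : W → ℝ}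
    (hf : ContDiffOn ℝ ∞ f V) (hfN : ∀ q ∈ V, q ∈ N ↔ f q = 0)
    (hv : 0 < fderiv ℝ f p (ν p)) : ∀ᶠ q in 𝓝 p, q ∈ C → f q ≤ 0 := by
  obtain ⟨-, hpN, U, U₁, U₂, hU, hpU, hU₁, hU₂, -, -, hdisj, hUN, hC, hν⟩ := h
  obtain ⟨r, hr, hrV, hmono⟩ := exists_ball_strictMonoOn_line hV hp hf hv
  obtain ⟨r', hr', hr'U⟩ := Metric.isOpen_iff.1 hU p hpU
  set ρ := min r r' with hρ
  have hρ0 : 0 < ρ := lt_min hr hr'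
  have hline : ContinuousAt (fun t : ℝ => p + t • ν p) 0 := by fun_prop
  -- Half of the radius is spent on the displacement along `ν p`, the other half on moving the base
  -- point from `p` to `q`.
  have hsmall : ∀ᶠ t : ℝ in 𝓝[>] 0, ∀ s ∈ Icc 0 t, p + s • ν p ∈ Metric.ball p (ρ / 2) := by
    have h1 : ∀ᶠ t : ℝ in 𝓝 0, p + t • ν p ∈ Metric.ball p (ρ / 2) :=
      hline (by simpa using Metric.ball_mem_nhds p (half_pos hρ0))
    obtain ⟨δ, hδ, h2⟩ := Metric.eventually_nhds_iff_ball.1 h1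
    filter_upwards [Ioo_mem_nhdsGT hδ] with t ht s hs
    exact h2 s (by
      rw [Metric.mem_ball, Real.dist_eq, sub_zero, abs_of_nonneg hs.1]; exact hs.2.trans_lt ht.2)
  obtain ⟨t, ⟨ht, htU⟩, ht0⟩ := ((hsmall.and hν).and self_mem_nhdsWithin).exists
  replace ht0 : 0 < t := ht0
  have hend : ∀ᶠ q in 𝓝 p, q + t • ν p ∈ U₂ := by
    have : ContinuousAt (fun q : W => q + t • ν p) p := by fun_prop
    exact this (hU₂.mem_nhds htU.2)
  filter_upwards [hend, Metric.ball_mem_nhds p (half_pos hρ0)] with q hq hqb hqC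
  -- If `0 < f q`, then `f` stays positive on the segment from `q` to `q + t • ν p`. The segment
  -- therefore avoids `N`, and being connected with its endpoint in `U₂` it lies in `U₂`. But `q ∈
  -- C` forces `q ∈ closure U₁`, which is disjoint from the open set `U₂`.
  by_contra! hfq
  have hseg (s : ℝ) (hs : s ∈ Icc 0 t) : q + s • ν p ∈ Metric.ball p ρ := by
    have h1 := ht s hs
    rw [Metric.mem_ball, dist_eq_norm] at h1 hqb ⊢
    calc ‖q + s • ν p - p‖ = ‖(q - p) + (p + s • ν p - p)‖ := by congr 1; abel
      _ ≤ ‖q - p‖ + ‖p + s • ν p - p‖ := norm_add_le _ _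
      _ < ρ := by linarith
  have hsegr (s : ℝ) (hs : s ∈ Icc 0 t) : q + s • ν p ∈ Metric.ball p r :=
    Metric.ball_subset_ball (min_le_left _ _) (hseg s hs)
  have hpos (s : ℝ) (hs : s ∈ Icc 0 t) : 0 < f (q + s • ν p) := by
    rcases hs.1.eq_or_lt with rfl | h0
    · simpa using hfq
    · exact hfq.trans (hmono q s h0 fun a ha => hsegr a ⟨ha.1, ha.2.trans hs.2⟩)
  have hsub : (fun s : ℝ => q + s • ν p) '' Icc 0 t ⊆ U₁ ∪ U₂ := by
    rw [← hUN]
    rintro _ ⟨s, hs, rfl⟩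
    refine ⟨hr'U (Metric.ball_subset_ball (min_le_right _ _) (hseg s hs)), fun hN => ?_⟩
    exact (hpos s hs).ne' ((hfN _ (hrV (hsegr s hs))).1 hN)
  have hconn : IsPreconnected ((fun s : ℝ => q + s • ν p) '' Icc 0 t) :=
    isPreconnected_Icc.image _ (by fun_prop)
  have hsub₂ : (fun s : ℝ => q + s • ν p) '' Icc 0 t ⊆ U₂ :=
    hconn.subset_right_of_subset_union hU₁ hU₂ hdisj hsub
      ⟨_, ⟨t, right_mem_Icc.2 ht0.le, rfl⟩, hq⟩
  have hqU₂ : q ∈ U₂ := by simpa using hsub₂ ⟨0, left_mem_Icc.2 ht0.le, rfl⟩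
  have hqU : q ∈ U := by
    have := hr'U (Metric.ball_subset_ball (min_le_right _ _) (hseg 0 (left_mem_Icc.2 ht0.le)))
    simpa using this
  have hq₁ : q ∈ closure U₁ := hC ⟨hqC, subset_closure hqU⟩
  exact (Set.disjoint_left.1 (hdisj.closure_left hU₂)) hq₁ hqU₂

/-- Only the derivative at the single point `0` is needed: the difference quotients tend to `c > 0`.
-/
theorem HasDerivAt.eventually_pos_of_eq_zero {g : ℝ → ℝ} {c : ℝ} (h : HasDerivAt g c 0)
    (h0 : g 0 = 0) (hc : 0 < c) : ∀ᶠ t in 𝓝[>] 0, 0 < g t := by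
  have h1 := (hasDerivAt_iff_tendsto_slope.1 h).mono_left (nhdsGT_le_nhdsNE 0)
  filter_upwards [h1.eventually (lt_mem_nhds hc), self_mem_nhdsWithin] with t ht ht0
  rw [slope_def_field, h0, sub_zero, sub_zero] at ht
  exact (div_pos_iff_of_pos_right ht0).1 ht

/-- The kernel of the derivative of a defining function consists of tangent vectors. -/
theorem mem_tangentConeAt_of_levelset {f : W → ℝ} {p X v : W} {f' : W →L[ℝ] ℝ}
    (hc : ∀ᶠ q in 𝓝 p, ContinuousAt f q) (hf : HasFDerivAt f f' p) (hp : f p = 0) (hX : f' X = 0)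
    (hv : 0 < f' v) {N : Set W} (hN : ∀ᶠ q in 𝓝 p, f q = 0 → q ∈ N) :
    X ∈ tangentConeAt ℝ N p := by
  have hline (Y : W) : HasDerivAt (fun t : ℝ => f (p + t • Y)) (f' Y) 0 := by
    have h2 : HasDerivAt (fun t : ℝ => p + t • Y) Y 0 := by
      simpa using ((hasDerivAt_id (0 : ℝ)).smul_const Y).const_add p
    have h1 : HasFDerivAt f f' (p + (0 : ℝ) • Y) := by simpa using hf
    exact h1.comp_hasDerivAt (0 : ℝ) h2
  -- To first order `f` is positive at `p + t • (X + η • v)` and negative at `p + t • (X - η • v)`.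
  -- For small `t` the intermediate value theorem gives a zero of `f` between these points. Letting
  -- `η` tend to `0` produces secants of `N` with limit `X`.
  have key (η : ℝ) (hη : 0 < η) :
      ∃ t a : ℝ, 0 < t ∧ t < η ∧ |a| ≤ η ∧ p + t • (X + a • v) ∈ N := by
    have h1 := (hline (X + η • v)).eventually_pos_of_eq_zero (by simpa using hp)
      (by simpa [hX] using mul_pos hη hv)
    have h2 := (hline (X + (-η) • v)).neg.eventually_pos_of_eq_zero (by simpa using hp)
      (by simpa [hX] using mul_pos hη hv)
    obtain ⟨r, hr, hball⟩ := Metric.eventually_nhds_iff_ball.1 (hc.and hN)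
    have h3 : ∀ᶠ t : ℝ in 𝓝[>] 0, t * (‖X‖ + η * ‖v‖) < r := by
      have : ContinuousAt (fun t : ℝ => t * (‖X‖ + η * ‖v‖)) 0 := by fun_prop
      exact nhdsWithin_le_nhds (this.eventually (gt_mem_nhds (by simpa using hr)))
    obtain ⟨t, ⟨⟨h1, h2⟩, h3⟩, ht⟩ := (((h1.and h2).and h3).and (Ioo_mem_nhdsGT hη)).exists
    have hmem (a : ℝ) (ha : a ∈ Icc (-η) η) : p + t • (X + a • v) ∈ Metric.ball p r := by
      rw [Metric.mem_ball, dist_eq_norm, add_sub_cancel_left, norm_smul, Real.norm_eq_abs,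
        abs_of_pos ht.1]
      refine lt_of_le_of_lt (mul_le_mul_of_nonneg_left ((norm_add_le _ _).trans ?_) ht.1.le) h3
      rw [norm_smul]
      gcongr
      exact abs_le.2 ha
    have hcont : ContinuousOn (fun a : ℝ => f (p + t • (X + a • v))) (Icc (-η) η) := fun a ha =>
      ContinuousAt.continuousWithinAt (ContinuousAt.comp (f := fun a : ℝ => p + t • (X + a • v))
        (hball _ (hmem a ha)).1 (by fun_prop))
    obtain ⟨a, ha, ha0⟩ := intermediate_value_Icc (by linarith) hcont
      (show (0 : ℝ) ∈ Icc _ _ from ⟨(neg_pos.1 h2).le, h1.le⟩)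
    exact ⟨t, a, ht.1, ht.2, abs_le.2 ha, (hball _ (hmem a ha)).2 ha0⟩
  choose t a ht0 ht ha hmem using fun k : ℕ => key (1 / ((k : ℝ) + 1)) Nat.one_div_pos_of_nat
  have h0 := tendsto_one_div_add_atTop_nhds_zero_nat (𝕜 := ℝ)
  have ht' : Tendsto t atTop (𝓝 0) :=
    squeeze_zero (fun k => (ht0 k).le) (fun k => (ht k).le) h0
  have ha' : Tendsto a atTop (𝓝 0) := squeeze_zero_norm (fun k => by simpa using ha k) h0
  have hXa : Tendsto (fun k => X + a k • v) atTop (𝓝 X) := by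
    simpa using (ha'.smul_const v).const_add X
  refine mem_tangentConeAt_of_seq atTop (fun k => (t k)⁻¹) (fun k => t k • (X + a k • v)) ?_
    (Eventually.of_forall hmem) ?_
  · simpa using ht'.smul hXa
  · refine hXa.congr fun k => ?_
    rw [smul_smul, inv_mul_cancel₀ (ht0 k).ne', one_smul]

/-- Second derivative test: necessary condition at a local maximum. -/
theorem IsLocalMax.second_deriv_nonpos {g g1 : ℝ → ℝ} {a c : ℝ} (h : IsLocalMax g a)
    (h1 : ∀ᶠ t in 𝓝 a, HasDerivAt g (g1 t) t) (h2 : HasDerivAt g1 c a) : c ≤ 0 := by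
  -- A positive second derivative would make `a` a local minimum as well. Then `g` is locally
  -- constant and its second derivative vanishes.
  by_contra! hc
  have hd : deriv g =ᶠ[𝓝 a] g1 := by filter_upwards [h1] with t ht using ht.deriv
  have hdd : deriv (deriv g) a = c := by rw [hd.deriv_eq, h2.deriv]
  have hmin : IsLocalMin g a := isLocalMin_of_deriv_deriv_pos (hdd ▸ hc) h.deriv_eq_zero
    h1.self_of_nhds.continuousAt
  have hconst : g =ᶠ[𝓝 a] fun _ => g a := by
    filter_upwards [h, hmin] with t ht ht' using le_antisymm ht ht'
  have h0 : deriv g =ᶠ[𝓝 a] fun _ => 0 := by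
    filter_upwards [hconst.eventuallyEq_nhds] with t ht
    rw [ht.deriv_eq, deriv_const]
  rw [h0.deriv_eq, deriv_const] at hdd
  exact hc.ne hdd

/-- The second fundamental form of a cooriented hypersurface in terms of a defining function. -/
theorem secondFundamentalForm_eq [CompleteSpace W] {N : Set W} {ν : W → W} {p : W} (hp : p ∈ N) {V : Set W}
    (hV : IsOpen V) (hpV : p ∈ V) {f : W → ℝ} (hf : ContDiffOn ℝ ∞ f V)
    (hfN : ∀ q ∈ V, q ∈ N ↔ f q = 0)
    (hν : ∀ q ∈ N ∩ V, ‖ν q‖ = 1 ∧ ∃ c : ℝ, 0 < c ∧ fderiv ℝ f q = c • innerSL ℝ (ν q))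
    {c : ℝ} (hc : 0 < c) (hpc : fderiv ℝ f p = c • innerSL ℝ (ν p)) {X Y : W}
    (hX : inner ℝ X (ν p) = 0) (hY : inner ℝ Y (ν p) = 0) :
    c * secondFundamentalForm N ν p X Y = -fderiv ℝ (fderiv ℝ f) p X Y := by
  have hνp := (hν p ⟨hp, hpV⟩).1
  have hD : HasFDerivAt (fderiv ℝ f) (fderiv ℝ (fderiv ℝ f) p) p := by
    have : ContDiffOn ℝ 1 (fderiv ℝ f) V := hf.fderiv_of_isOpen hV (by norm_cast)
    exact ((this.differentiableOn (by simp)).differentiableAt (hV.mem_nhds hpV)).hasFDerivAt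
  let D := fderiv ℝ f
  -- The field `ν` is arbitrary off `N`. On `N ∩ V` it equals the normalized gradient `‖u‖⁻¹ • u`,
  -- which can be differentiated at `p` in the ambient space.
  let u : W → W := fun q => (InnerProductSpace.toDual ℝ W).symm (D q)
  have hu (q : W) (c : ℝ) (h : D q = c • innerSL ℝ (ν q)) : u q = c • ν q := by
    refine ext_inner_right ℝ fun w => ?_
    simp only [u, InnerProductSpace.toDual_symm_apply, h, real_inner_smul_left]
    rfl
  have hud : DifferentiableAt ℝ u p :=
    (InnerProductSpace.toDual ℝ W).symm.toContinuousLinearEquiv.differentiableAt.comp p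
      hD.differentiableAt
  have hup : u p = c • ν p := hu p c hpc
  have hnorm : ‖u p‖ = c := by rw [hup, norm_smul, hνp, mul_one, Real.norm_of_nonneg hc.le]
  have hup0 : u p ≠ 0 := norm_pos_iff.1 (hnorm ▸ hc)
  have hm : DifferentiableAt ℝ (fun q => ‖u q‖⁻¹) p :=
    (hud.norm ℝ hup0).inv (by rw [hnorm]; exact hc.ne')
  have hDY : HasFDerivAt (fun q => D q Y) ((fderiv ℝ (fderiv ℝ f) p).flip Y) p := by
    simpa using hD.clm_apply (hasFDerivAt_const Y p)
  have hDpY : D p Y = 0 := by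
    change fderiv ℝ f p Y = 0
    rw [hpc]
    change c * inner ℝ (ν p) Y = 0
    rw [real_inner_comm, hY, mul_zero]
  have hφ : HasFDerivAt (fun q => ‖u q‖⁻¹ * D q Y) _ p := hm.hasFDerivAt.mul hDY
  have hn : DifferentiableAt ℝ (fun q => ‖u q‖⁻¹ • u q) p := hm.smul hud
  have hG : HasFDerivAt (fun q => Y - (‖u q‖⁻¹ * D q Y) • (‖u q‖⁻¹ • u q)) _ p :=
    (hφ.smul hn.hasFDerivAt).const_sub Y
  have heq (q : W) (hq : q ∈ N ∩ V) : Y - inner ℝ Y (ν q) • ν q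
      = Y - (‖u q‖⁻¹ * D q Y) • (‖u q‖⁻¹ • u q) := by
    obtain ⟨h1, d, hd, hqd⟩ := hν q hq
    have h2 : ‖u q‖ = d := by rw [hu q d hqd, norm_smul, h1, mul_one, Real.norm_of_nonneg hd.le]
    have h3 : D q Y = d * inner ℝ Y (ν q) := by
      change fderiv ℝ f q Y = _
      rw [hqd, real_inner_comm]
      rfl
    rw [h2, hu q d hqd, h3, inv_mul_cancel_left₀ hd.ne', smul_smul d⁻¹ d,
      inv_mul_cancel₀ hd.ne', one_smul]
  have hF := (hG.hasFDerivWithinAt (s := N)).congr_of_eventuallyEq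
    (f₁ := fun q => Y - inner ℝ Y (ν q) • ν q)
    (by
      filter_upwards [self_mem_nhdsWithin, nhdsWithin_le_nhds (hV.mem_nhds hpV)] with q h1 h2
      exact heq q ⟨h1, h2⟩) (heq p ⟨hp, hpV⟩)
  have hDX : D p X = 0 := by
    change fderiv ℝ f p X = 0
    rw [hpc]
    change c * inner ℝ (ν p) X = 0
    rw [real_inner_comm, hX, mul_zero]
  have htan : X ∈ tangentConeAt ℝ N p := by
    refine mem_tangentConeAt_of_levelset (f := f) (f' := D p) (v := ν p) ?_ ?_
      ((hfN p hpV).1 hp) hDX ?_ ?_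
    · filter_upwards [hV.mem_nhds hpV] with q hq
      exact hf.continuousOn.continuousAt (hV.mem_nhds hq)
    · exact ((hf.differentiableOn (by simp)).differentiableAt (hV.mem_nhds hpV)).hasFDerivAt
    · change 0 < fderiv ℝ f p (ν p)
      rw [hpc]
      simpa [hνp] using hc
    · filter_upwards [hV.mem_nhds hpV] with q hq using (hfN q hq).2
  -- A derivative within the hypersurface `N` is not unique as a linear map, since the normal
  -- direction is undetermined. Any two such derivatives agree on the tangent cone, which contains
  -- `X`.
  have hval := hF.differentiableWithinAt.hasFDerivWithinAt.unique_on hF htan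
  rw [secondFundamentalForm, hval]
  simp only [neg_apply, smul_apply, ContinuousLinearMap.smulRight_apply,
    ContinuousLinearMap.flip_apply, hDpY, zero_smul, mul_zero, zero_add, add_zero, hnorm,
    smul_eq_mul]
  rw [hup]
  rw [smul_smul c⁻¹ c, inv_mul_cancel₀ hc.ne', one_smul, inner_neg_left, real_inner_smul_left,
    real_inner_self_eq_norm_sq, hνp]
  field_simp

/-- The function `f ∘ r` has a local maximum at `0`. Its second derivative there is `-c II(r', r') +
c ⟨a, ν⟩` with `c = ‖grad f‖ > 0`: the first term comes from the Hessian of `f` on tangent vectors,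
the second from the acceleration. -/
theorem IsSupportingHypersurface.second_variation [CompleteSpace W] {C N : Set W} {ν : W → W} {p : W}
    (h : IsSupportingHypersurface C N ν p) {r r1 : ℝ → W} {a : W} (hr0 : r 0 = p)
    (hrC : ∀ᶠ t in 𝓝 0, r t ∈ C) (hr1 : ∀ᶠ t in 𝓝 0, HasDerivAt r (r1 t) t)
    (hr2 : HasDerivAt r1 a 0) : inner ℝ (r1 0) (ν p) = 0 ∧
      inner ℝ a (ν p) ≤ secondFundamentalForm N ν p (r1 0) (r1 0) := by
  obtain ⟨V, hV, hpV, f, hf, hfN, hν⟩ := h.1 p h.2.1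
  obtain ⟨hν1, c, hc, hpc⟩ := hν p ⟨h.2.1, hpV⟩
  have hνp : 0 < fderiv ℝ f p (ν p) := by
    rw [hpc]
    simpa [hν1] using hc
  have hev := h.eventually_nonpos hV hpV hf hfN hνp
  have hrcont : Tendsto r (𝓝 0) (𝓝 p) := hr0 ▸ hr1.self_of_nhds.continuousAt
  have hfp : f p = 0 := (hfN p hpV).1 h.2.1
  have hmax : IsLocalMax (fun t => f (r t)) 0 := by
    filter_upwards [hrC, hrcont.eventually hev] with t ht ht'
    rw [hr0, hfp]
    exact ht' ht
  have hfd (q : W) (hq : q ∈ V) : HasFDerivAt f (fderiv ℝ f q) q :=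
    ((hf.differentiableOn (by simp)).differentiableAt (hV.mem_nhds hq)).hasFDerivAt
  have h1 : ∀ᶠ t in 𝓝 0, HasDerivAt (fun t => f (r t)) (fderiv ℝ f (r t) (r1 t)) t := by
    filter_upwards [hr1, hrcont.eventually (hV.eventually_mem hpV)] with t ht htV
    exact (hfd _ htV).comp_hasDerivAt t ht
  have hfd2 : HasFDerivAt (fderiv ℝ f) (fderiv ℝ (fderiv ℝ f) p) (r 0) := by
    rw [hr0]
    have : ContDiffOn ℝ 1 (fderiv ℝ f) V := hf.fderiv_of_isOpen hV (by norm_cast)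
    exact ((this.differentiableOn (by simp)).differentiableAt (hV.mem_nhds hpV)).hasFDerivAt
  have h2 : HasDerivAt (fun t => fderiv ℝ f (r t) (r1 t))
      (fderiv ℝ (fderiv ℝ f) p (r1 0) (r1 0) + fderiv ℝ f (r 0) a) 0 :=
    (hfd2.comp_hasDerivAt (0 : ℝ) hr1.self_of_nhds).clm_apply hr2
  have hd0 : fderiv ℝ f p (r1 0) = 0 := by
    rw [← hr0]
    exact hmax.hasDerivAt_eq_zero h1.self_of_nhds
  have horth : inner ℝ (r1 0) (ν p) = 0 := by
    rw [hpc] at hd0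
    rw [real_inner_comm]
    simpa [hc.ne'] using hd0
  refine ⟨horth, ?_⟩
  have hle := hmax.second_deriv_nonpos h1 h2
  have hII := secondFundamentalForm_eq h.2.1 hV hpV hf hfN hν hc hpc horth horth
  rw [hr0, hpc] at hle
  have he : (c • innerSL ℝ (ν p)) a = c * inner ℝ a (ν p) := by
    rw [real_inner_comm]; rfl
  rw [he] at hle
  nlinarith

end

/-! ### The Levi-Civita connection in a fixed trivialization -/

section
open FiberBundle
variable {E : Type*} [NormedAddCommGroup E] [NormedSpace ℝ E] [FiniteDimensional ℝ E]
  {H : Type*} [TopologicalSpace H] {I : ModelWithCorners ℝ E H}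
  {M : Type*} [TopologicalSpace M] [ChartedSpace H M] [IsManifold I ∞ M]

theorem tangentTransition_back {x y : M}
    (hy : y ∈ (trivializationAt E (TangentSpace I) x).baseSet) (v : TangentSpace I y) :
    tangentTransition x y (tangentTransitionBack x y v) = v := by
  simp only [tangentTransition, tangentTransitionBack, ContinuousLinearMap.comp_apply]
  rw [Trivialization.continuousLinearMapAt_symmL _ (mem_baseSet_trivializationAt' x),
    Trivialization.symmL_continuousLinearMapAt _ hy]

theorem tangentTransitionBack_extendField {x y : M}
    (hy : y ∈ (trivializationAt E (TangentSpace I) x).baseSet) (v : TangentSpace I x) :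
    tangentTransitionBack x y (extendField v y) = v := by
  simp only [extendField, tangentTransition, tangentTransitionBack,
    ContinuousLinearMap.comp_apply]
  rw [Trivialization.continuousLinearMapAt_symmL _ hy,
    Trivialization.symmL_continuousLinearMapAt _ (mem_baseSet_trivializationAt' x)]

theorem extendField_tangentTransitionBack {x y : M}
    (hy : y ∈ (trivializationAt E (TangentSpace I) x).baseSet) (v : TangentSpace I y) :
    extendField (tangentTransitionBack x y v) y = v :=
  tangentTransition_back hy v

theorem tangentTransitionBack_self (x : M) (v : TangentSpace I x) :
    tangentTransitionBack x x v = v := by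
  have h := tangentTransitionBack_extendField
    (mem_baseSet_trivializationAt' (F := E) (E := TangentSpace I) x) v
  rwa [extendField_self v] at h

theorem tangentTransitionBack_of_notMem {x y : M}
    (hy : y ∉ (trivializationAt E (TangentSpace I) x).baseSet) (v : TangentSpace I y) :
    tangentTransitionBack x y v = 0 := by
  simp only [tangentTransitionBack, ContinuousLinearMap.comp_apply]
  rw [Trivialization.continuousLinearMapAt_apply, Trivialization.linearMapAt_def_of_notMem _ hy]
  simp

variable [RiemannianBundle (fun x : M => TangentSpace I x)]
  [IsContMDiffRiemannianBundle I ∞ E (fun x : M => TangentSpace I x)]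

theorem eventually_coord_eq {x y : M}
    (hy : y ∈ (trivializationAt E (TangentSpace I) x).baseSet) (X : Π z : M, TangentSpace I z) :
    ∀ᶠ z in 𝓝 y, tangentTransitionBack x z (X z) =
      (trivializationAt E (TangentSpace I) x).symmL ℝ x
        (trivializationAt E (TangentSpace I) x ⟨z, X z⟩).2 := by
  filter_upwards [(trivializationAt E (TangentSpace I) x).open_baseSet.mem_nhds hy] with z hz
  simp only [tangentTransitionBack, ContinuousLinearMap.comp_apply,
    Trivialization.continuousLinearMapAt_apply, Trivialization.coe_linearMapAt_of_mem _ hz]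

theorem mdifferentiableAt_tangentTransitionBack {x y : M}
    (hy : y ∈ (trivializationAt E (TangentSpace I) x).baseSet) {X : Π z : M, TangentSpace I z}
    (hX : MDiffAt (T% X) y) :
    MDifferentiableAt I 𝓘(ℝ, TangentSpace I x) (fun z => tangentTransitionBack x z (X z)) y := by
  have h := ((trivializationAt E (TangentSpace I) x).mdifferentiableAt_section_iff I X hy).1 hX
  exact (((trivializationAt E (TangentSpace I) x).symmL ℝ x).mdifferentiableAt.comp y
    h).congr_of_eventuallyEq (eventually_coord_eq hy X)

theorem contMDiffAt_extendField {n : ℕ∞} {x y : M}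
    (hy : y ∈ (trivializationAt E (TangentSpace I) x).baseSet) (v : TangentSpace I x) :
    CMDiffAt n (T% (extendField v)) y := by
  refine ((trivializationAt E (TangentSpace I) x).contMDiffAt_section_iff hy).2 ?_
  refine (contMDiffAt_const
    (c := (trivializationAt E (TangentSpace I) x).continuousLinearMapAt ℝ x v)).congr_of_eventuallyEq
    ?_
  filter_upwards [(trivializationAt E (TangentSpace I) x).open_baseSet.mem_nhds hy] with z hz
  have h := Trivialization.continuousLinearMapAt_symmL (R := ℝ) _ hz
    ((trivializationAt E (TangentSpace I) x).continuousLinearMapAt ℝ x v)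
  rw [Trivialization.continuousLinearMapAt_apply,
    Trivialization.coe_linearMapAt_of_mem _ hz] at h
  exact h

theorem mdifferentiableAt_extendField_of_mem {x y : M}
    (hy : y ∈ (trivializationAt E (TangentSpace I) x).baseSet) (v : TangentSpace I x) :
    MDiffAt (T% (extendField v)) y :=
  (contMDiffAt_extendField (n := 1) hy v).mdifferentiableAt (by simp)

theorem mvfderiv_clm_comp {F F' : Type*} [NormedAddCommGroup F] [NormedSpace ℝ F]
    [NormedAddCommGroup F'] [NormedSpace ℝ F'] (L : F →L[ℝ] F') {f : M → F} {y : M}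
    (hf : MDifferentiableAt I 𝓘(ℝ, F) f y) (v : TangentSpace I y) :
    mvfderiv I (fun z => L (f z)) y v = L (mvfderiv I f y v) := by
  have h : HasMFDerivAt I 𝓘(ℝ, F') (L ∘ f) y (L.comp (mfderiv I 𝓘(ℝ, F) f y)) :=
    HasMFDerivAt.comp y L.hasMFDerivAt hf.hasMFDerivAt
  change mfderiv I 𝓘(ℝ, F') (L ∘ f) y v = _
  rw [h.mfderiv]
  rfl

theorem leviCivita_sum {ι : Type*} (s : Finset ι) {σ : ι → Π y : M, TangentSpace I y} {y : M}
    (h : ∀ i, MDiffAt (T% (σ i)) y) :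
    leviCivita I M (∑ i ∈ s, σ i) y = ∑ i ∈ s, leviCivita I M (σ i) y ∧
      MDiffAt (T% (∑ i ∈ s, σ i)) y := by
  classical
  induction s using Finset.induction_on with
  | empty =>
    rw [Finset.sum_empty, Finset.sum_empty]
    exact ⟨(leviCivita I M).isCovariantDerivativeOn.zero, mdifferentiableAt_zeroSection ..⟩
  | insert i s hi ih =>
    rw [Finset.sum_insert hi, Finset.sum_insert hi,
      (leviCivita I M).isCovariantDerivativeOnUniv.add (h i) ih.2, ih.1]
    exact ⟨rfl, mdifferentiableAt_add_section (h i) ih.2⟩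

/-- The Christoffel symbols at `y` with respect to the trivialization of the tangent bundle around
`x`: the endomorphism of `T_xM` that corresponds to `u ↦ ∇_v (extendField u)` at `y`. -/
noncomputable def frameChristoffel (x y : M) (v : TangentSpace I y) :
    TangentSpace I x →L[ℝ] TangentSpace I x :=
  LinearMap.toContinuousLinearMap
    { toFun := fun u => tangentTransitionBack x y (leviCivita I M (extendField u) y v)
      map_add' := fun u u' => by
        -- On the base set the extended fields are differentiable, so the connection is additive on
        -- them. Off the base set `tangentTransitionBack` is zero.
        by_cases hy : y ∈ (trivializationAt E (TangentSpace I) x).baseSet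
        · rw [extendField_add, (leviCivita I M).isCovariantDerivativeOnUniv.add
            (mdifferentiableAt_extendField_of_mem hy u)
            (mdifferentiableAt_extendField_of_mem hy u'), add_apply, map_add]
        · simp only [tangentTransitionBack_of_notMem hy, add_zero]
      map_smul' := fun c u => by
        by_cases hy : y ∈ (trivializationAt E (TangentSpace I) x).baseSet
        · rw [extendField_smul, (leviCivita I M).isCovariantDerivativeOnUniv.smul_const c
            (mdifferentiableAt_extendField_of_mem hy u), smul_apply, map_smul, RingHom.id_apply]
        · simp only [tangentTransitionBack_of_notMem hy, smul_zero] }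

theorem frameChristoffel_apply (x y : M) (v : TangentSpace I y) (u : TangentSpace I x) :
    frameChristoffel x y v u = tangentTransitionBack x y (leviCivita I M (extendField u) y v) :=
  rfl

theorem frameChristoffel_self (x : M) (v : TangentSpace I x) :
    frameChristoffel x x v = christoffelEnd x v := by
  ext u
  rw [frameChristoffel_apply, tangentTransitionBack_self]
  rfl

/-- The Levi-Civita connection in the trivialization around `x`. -/
theorem tangentTransitionBack_leviCivita {x y : M}
    (hy : y ∈ (trivializationAt E (TangentSpace I) x).baseSet) {X : Π z : M, TangentSpace I z}
    (hX : MDiffAt (T% X) y) (v : TangentSpace I y) :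
    tangentTransitionBack x y (leviCivita I M X y v) =
      mvfderiv I (fun z => tangentTransitionBack x z (X z)) y v
        + frameChristoffel x y v (tangentTransitionBack x y (X y)) := by
  let b := stdOrthonormalBasis ℝ (TangentSpace I x)
  -- These are the components of `X` in the frame `extendField (b i)`. The Leibniz rule for `X = ∑ c
  -- i • extendField (b i)` separates the derivative of the components from the Christoffel term.
  let c (i) : M → ℝ := fun z => innerSL ℝ (b i) (tangentTransitionBack x z (X z))
  have hXc := mdifferentiableAt_tangentTransitionBack hy hX
  have hc (i) : MDiffAt (c i) y := (innerSL ℝ (b i)).mdifferentiableAt.comp y hXc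
  have hb (i) : MDiffAt (T% (extendField (b i))) y := mdifferentiableAt_extendField_of_mem hy _
  have hcb (i) : MDiffAt (T% (c i • extendField (b i))) y := (hc i).smul_section (hb i)
  have hsum := leviCivita_sum Finset.univ hcb
  have hex (w : TangentSpace I x) : ∑ i, innerSL ℝ (b i) w • b i = w := b.sum_repr' w
  have hXe : ∀ᶠ z in 𝓝 y, X z = (∑ i, c i • extendField (b i)) z := by
    filter_upwards [(trivializationAt E (TangentSpace I) x).open_baseSet.mem_nhds hy] with z hz
    rw [Finset.sum_apply]
    simp only [Pi.smul_apply', c]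
    have h2 : ∑ i, innerSL ℝ (b i) (tangentTransitionBack x z (X z)) • extendField (b i) z =
        tangentTransition x z (∑ i, innerSL ℝ (b i) (tangentTransitionBack x z (X z)) • b i) := by
      rw [map_sum]
      simp only [map_smul]
      rfl
    rw [h2, hex, tangentTransition_back hz]
  rw [(leviCivita I M).isCovariantDerivativeOnUniv.congr_of_eventuallyEq hX hsum.2 univ_mem hXe]
  rw [hsum.1, sum_apply, map_sum]
  have hterm (i) : tangentTransitionBack x y (leviCivita I M (c i • extendField (b i)) y v) =
      innerSL ℝ (b i) (mvfderiv I (fun z => tangentTransitionBack x z (X z)) y v) • b i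
        + innerSL ℝ (b i) (tangentTransitionBack x y (X y)) • frameChristoffel x y v (b i) := by
    rw [(leviCivita I M).isCovariantDerivativeOnUniv.leibniz (hb i) (hc i), add_apply, map_add,
      smul_apply, map_smul, ContinuousLinearMap.smulRight_apply, map_smul,
      tangentTransitionBack_extendField hy, add_comm]
    congr 2
    exact mvfderiv_clm_comp _ hXc v
  rw [Finset.sum_congr rfl fun i _ => hterm i, Finset.sum_add_distrib, hex]
  congr 1
  conv_rhs => rw [← hex (tangentTransitionBack x y (X y)), map_sum]
  simp only [map_smul]

end

/-! ### Coordinate fields and straight lines in a chart -/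

section
open FiberBundle VectorField
variable {E : Type*} [NormedAddCommGroup E] [NormedSpace ℝ E] [FiniteDimensional ℝ E]
  {H : Type*} [TopologicalSpace H] {I : ModelWithCorners ℝ E H}
  {M : Type*} [TopologicalSpace M] [ChartedSpace H M] [IsManifold I ∞ M]
  [RiemannianBundle (fun x : M => TangentSpace I x)]
  [IsContMDiffRiemannianBundle I ∞ E (fun x : M => TangentSpace I x)]

theorem mem_baseSet_iff_mem_extChartAt_source {x y : M} :
    y ∈ (trivializationAt E (TangentSpace I) x).baseSet ↔ y ∈ (extChartAt I x).source := by
  rw [extChartAt_source]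
  rfl

section Curve
variable [I.Boundaryless]

/-- The coordinates in the model space of a tangent vector at the centre of a chart. -/
noncomputable def chartVector (x : M) (v : TangentSpace I x) : E :=
  (trivializationAt E (TangentSpace I) x).continuousLinearMapAt ℝ x v

theorem hasMFDerivAt_extChartAt_symm {x y : M} (hy : y ∈ (extChartAt I x).source) :
    HasMFDerivAt 𝓘(ℝ, E) I (extChartAt I x).symm (extChartAt I x y)
      (mfderiv 𝓘(ℝ, E) I (extChartAt I x).symm (extChartAt I x y)) := by
  refine MDifferentiableAt.hasMFDerivAt ?_
  have h := contMDiffOn_extChartAt_symm (I := I) (n := 1) x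
  exact ((h _ ((extChartAt I x).map_source hy)).contMDiffAt
    ((isOpen_extChartAt_target x).mem_nhds ((extChartAt I x).map_source hy))).mdifferentiableAt
      (by simp)

/-- The trivialization of the tangent bundle is the derivative of the chart, so the fields
`extendField v` are exactly the coordinate fields. Differentiation along them becomes
differentiation in a constant direction of `E`. -/
theorem mfderiv_extChartAt_symm_chartVector {x y : M} (hy : y ∈ (extChartAt I x).source)
    (v : TangentSpace I x) :
    mfderiv 𝓘(ℝ, E) I (extChartAt I x).symm (extChartAt I x y) (chartVector x v : E)
      = extendField v y := by
  have h := TangentBundle.symmL_trivializationAt (I := I) (𝕜 := ℝ) (x₀ := x) (x := y)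
    (by rwa [extChartAt_source] at hy)
  rw [I.range_eq_univ, mfderivWithin_univ] at h
  exact (congrArg (fun L => L (chartVector x v)) h).symm

/-- The directional derivative along a coordinate field, in the chart. -/
theorem mvfderiv_extendField {F : Type*} [NormedAddCommGroup F] [NormedSpace ℝ F] {x y : M}
    (hy : y ∈ (extChartAt I x).source) {f : M → F} (hf : MDifferentiableAt I 𝓘(ℝ, F) f y)
    (v : TangentSpace I x) :
    mvfderiv I f y (extendField v y) =
      fderiv ℝ (f ∘ (extChartAt I x).symm) (extChartAt I x y) (chartVector x v) := by
  have h1 := hasMFDerivAt_extChartAt_symm (I := I) hy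
  have e : (extChartAt I x).symm (extChartAt I x y) = y := (extChartAt I x).left_inv hy
  have h2 : HasMFDerivAt I 𝓘(ℝ, F) f ((extChartAt I x).symm (extChartAt I x y))
      (mfderiv I 𝓘(ℝ, F) f ((extChartAt I x).symm (extChartAt I x y))) := by
    rw [e]; exact hf.hasMFDerivAt
  have h3 := HasMFDerivAt.comp _ h2 h1
  rw [← mfderiv_eq_fderiv, h3.mfderiv]
  change _ = mfderiv I 𝓘(ℝ, F) f ((extChartAt I x).symm (extChartAt I x y))
    (mfderiv 𝓘(ℝ, E) I (extChartAt I x).symm (extChartAt I x y) (chartVector x v : E))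
  rw [mfderiv_extChartAt_symm_chartVector hy, e]
  rfl

/-- The directional derivative of a `C^(n+1)` function along a coordinate field is `C^n`. -/
theorem contMDiffAt_mvfderiv_extendField {F : Type*} [NormedAddCommGroup F] [NormedSpace ℝ F]
    {x : M} {f : M → F} (hf : ContMDiffAt I 𝓘(ℝ, F) 2 f x) (v : TangentSpace I x) :
    ContMDiffAt I 𝓘(ℝ, F) 1 (fun y => mvfderiv I f y (extendField v y)) x := by
  have h1 : ContDiffAt ℝ 2 (f ∘ (extChartAt I x).symm) (extChartAt I x x) := by
    have := (contMDiffAt_iff.1 hf).2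
    rw [I.range_eq_univ, contDiffWithinAt_univ] at this
    exact this
  have h2 : ContDiffAt ℝ 1 (fun p => fderiv ℝ (f ∘ (extChartAt I x).symm) p (chartVector x v))
      (extChartAt I x x) := (h1.fderiv_right (by norm_num)).clm_apply contDiffAt_const
  have h3 := h2.contMDiffAt.comp x (contMDiffAt_extChartAt (I := I) (x := x))
  refine h3.congr_of_eventuallyEq ?_
  have h4 : ∀ᶠ y in 𝓝 x, MDifferentiableAt I 𝓘(ℝ, F) f y := by
    filter_upwards [(contMDiffAt_iff_contMDiffAt_nhds (by simp)).1 hf] with y hy using hy.mdifferentiableAt (by simp)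
  filter_upwards [h4, extChartAt_source_mem_nhds (I := I) x] with y hy hy'
  exact mvfderiv_extendField hy' hy v

/-- The curve through `x` that is a straight line in the chart around `x`, with velocity `v`
at `x`. -/
noncomputable def chartLine (x : M) (v : TangentSpace I x) (t : ℝ) : M :=
  (extChartAt I x).symm (extChartAt I x x + t • chartVector x v)

theorem chartLine_zero (x : M) (v : TangentSpace I x) : chartLine x v 0 = x := by
  rw [chartLine, zero_smul, add_zero]
  exact extChartAt_to_inv x

theorem eventually_chartLine_mem_target (x : M) (v : TangentSpace I x) :
    ∀ᶠ t : ℝ in 𝓝 0, extChartAt I x x + t • chartVector x v ∈ (extChartAt I x).target := by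
  have h : ContinuousAt (fun t : ℝ => extChartAt I x x + t • chartVector x v) 0 := by fun_prop
  exact h (by simpa using extChartAt_target_mem_nhds x)

theorem contMDiffAt_chartLine {x : M} {v : TangentSpace I x} {t : ℝ}
    (ht : extChartAt I x x + t • chartVector x v ∈ (extChartAt I x).target) :
    ContMDiffAt 𝓘(ℝ, ℝ) I ∞ (chartLine x v) t := by
  have h1 := (contMDiffOn_extChartAt_symm (I := I) (n := ∞) x _ ht).contMDiffAt
    ((isOpen_extChartAt_target x).mem_nhds ht)
  have h2 : ContDiff ℝ ∞ (fun t : ℝ => extChartAt I x x + t • chartVector x v) := by fun_prop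
  exact h1.comp t h2.contMDiff.contMDiffAt

theorem chartLine_mem_source {x : M} {v : TangentSpace I x} {t : ℝ}
    (ht : extChartAt I x x + t • chartVector x v ∈ (extChartAt I x).target) :
    chartLine x v t ∈ (extChartAt I x).source := (extChartAt I x).map_target ht

/-- Chart lines are integral curves of coordinate fields. Differentiating twice along such a line
therefore means applying the covariant derivative along one and the same field twice. -/
theorem hasMFDerivAt_chartLine {x : M} {v : TangentSpace I x} {t : ℝ}
    (ht : extChartAt I x x + t • chartVector x v ∈ (extChartAt I x).target) :
    velocity I (chartLine x v) t = extendField v (chartLine x v t) := by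
  have h2 : HasMFDerivAt 𝓘(ℝ, ℝ) 𝓘(ℝ, E) (fun t : ℝ => extChartAt I x x + t • chartVector x v) t
      (ContinuousLinearMap.toSpanSingleton ℝ (chartVector x v : E)) := by
    refine HasFDerivAt.hasMFDerivAt ?_
    have : HasDerivAt (fun t : ℝ => extChartAt I x x + t • chartVector x v) (chartVector x v) t := by
      simpa using ((hasDerivAt_id t).smul_const (chartVector x v)).const_add (extChartAt I x x)
    exact this.hasFDerivAt
  have hs := chartLine_mem_source ht
  have e : extChartAt I x (chartLine x v t) = extChartAt I x x + t • chartVector x v :=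
    (extChartAt I x).right_inv ht
  have h1 := hasMFDerivAt_extChartAt_symm (I := I) hs
  rw [e] at h1
  have h3 : HasMFDerivAt 𝓘(ℝ, ℝ) I (chartLine x v) t _ := HasMFDerivAt.comp t h1 h2
  rw [velocity, h3.mfderiv]
  rw [← mfderiv_extChartAt_symm_chartVector hs, e]
  change mfderiv 𝓘(ℝ, E) I (extChartAt I x).symm (extChartAt I x x + t • chartVector x v)
    (ContinuousLinearMap.toSpanSingleton ℝ (chartVector x v : E) (1 : ℝ)) = _
  rw [ContinuousLinearMap.toSpanSingleton_apply, one_smul]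

/-- The chain rule along a curve. -/
theorem hasDerivAt_comp_curve {F : Type*} [NormedAddCommGroup F] [NormedSpace ℝ F] {γ : ℝ → M}
    {t : ℝ} (hγ : MDifferentiableAt 𝓘(ℝ, ℝ) I γ t) {f : M → F}
    (hf : MDifferentiableAt I 𝓘(ℝ, F) f (γ t)) :
    HasDerivAt (fun s => f (γ s)) (mvfderiv I f (γ t) (velocity I γ t)) t := by
  have h := HasMFDerivAt.comp t hf.hasMFDerivAt hγ.hasMFDerivAt
  have h' : HasFDerivAt (f ∘ γ)
      ((mvfderiv I f (γ t)).comp (mfderiv 𝓘(ℝ, ℝ) I γ t) : ℝ →L[ℝ] F) t := h.hasFDerivAt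
  exact h'.hasDerivAt

end Curve

/-- The definition of the connection at a point uses fields extended from that very point. For
fields extended from another point, the Koszul formula is recovered from metric compatibility and
vanishing torsion. -/
theorem inner_leviCivita_eq_koszul {U Y W : Π x : M, TangentSpace I x} {x : M}
    (hU : MDiffAt (T% U) x) (hY : MDiffAt (T% Y) x) (hW : MDiffAt (T% W) x) :
    inner ℝ (leviCivita I M Y x (U x)) (W x) = koszul I U Y W x := by
  have hm := leviCivita_isMetricCompatible (I := I) (M := M)
  have h1 := hm.mvfderiv_inner_eq U hY hW
  have h2 := hm.mvfderiv_inner_eq Y hU hW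
  have h3 := hm.mvfderiv_inner_eq W hU hY
  have : CompleteSpace E := FiniteDimensional.complete ℝ E
  have ht := leviCivita_torsion (I := I) (M := M)
  have tor {A B : Π x : M, TangentSpace I x} (hA : MDiffAt (T% A) x) (hB : MDiffAt (T% B) x) :
      mlieBracket I A B x = leviCivita I M B x (A x) - leviCivita I M A x (B x) := by
    have h := (leviCivita I M).torsion_apply hA hB
    rw [ht] at h
    exact (sub_eq_zero.1 h.symm).symm
  simp only [koszul]
  rw [h1, h2, h3, tor hU hY, tor hU hW, tor hY hW]
  simp only [inner_sub_left]
  rw [real_inner_comm (leviCivita I M W x (U x)) (Y x),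
    real_inner_comm (leviCivita I M W x (Y x)) (U x),
    real_inner_comm (leviCivita I M Y x (W x)) (U x)]
  ring

end

/-! ### Regularity of the Christoffel symbols -/

section
open FiberBundle VectorField
variable {E : Type*} [NormedAddCommGroup E] [NormedSpace ℝ E] [FiniteDimensional ℝ E]
  {H : Type*} [TopologicalSpace H] {I : ModelWithCorners ℝ E H}
  {M : Type*} [TopologicalSpace M] [ChartedSpace H M] [IsManifold I ∞ M]
  [RiemannianBundle (fun x : M => TangentSpace I x)]
  [IsContMDiffRiemannianBundle I ∞ E (fun x : M => TangentSpace I x)]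

theorem contMDiffAt_clm_of_apply {V F : Type*} [NormedAddCommGroup V] [InnerProductSpace ℝ V]
    [FiniteDimensional ℝ V] [NormedAddCommGroup F] [NormedSpace ℝ F] {n : ℕ∞} {G : M → V →L[ℝ] F}
    {x : M} (h : ∀ v, ContMDiffAt I 𝓘(ℝ, F) n (fun y => G y v) x) :
    ContMDiffAt I 𝓘(ℝ, V →L[ℝ] F) n G x := by
  let b := stdOrthonormalBasis ℝ V
  have e : G = fun y => ∑ i, ContinuousLinearMap.smulRightL ℝ V F (innerSL ℝ (b i)) (G y (b i)) := by
    ext y v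
    conv_lhs => rw [← b.sum_repr' v]
    simp
  rw [e]
  exact contMDiffAt_finsetSum fun i _ =>
    (ContinuousLinearMap.smulRightL ℝ V F (innerSL ℝ (b i))).contMDiff.contMDiffAt.comp x (h (b i))

/-- Inversion is smooth at units and `A y` is a unit near `x`, so `d = A⁻¹ K` there. It is used to
solve the Koszul formula for the covariant derivative. -/
theorem contMDiffAt_of_clm_apply_eq {V : Type*} [NormedAddCommGroup V] [InnerProductSpace ℝ V]
    [FiniteDimensional ℝ V] {n : ℕ∞} {A : M → V →L[ℝ] V} {K d : M → V} {x : M}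
    (hA : ContMDiffAt I 𝓘(ℝ, V →L[ℝ] V) n A x) (hK : ContMDiffAt I 𝓘(ℝ, V) n K x) (hAx : A x = 1)
    (h : ∀ᶠ y in 𝓝 x, A y (d y) = K y) : ContMDiffAt I 𝓘(ℝ, V) n d x := by
  have : CompleteSpace V := FiniteDimensional.complete ℝ V
  have hinv : ContMDiffAt I 𝓘(ℝ, V →L[ℝ] V) n (fun y => Ring.inverse (A y)) x := by
    have h1 : ContDiffAt ℝ n Ring.inverse (A x) := by
      rw [hAx]
      exact contDiffAt_ringInverse ℝ (1 : (V →L[ℝ] V)ˣ)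
    exact h1.contMDiffAt.comp x hA
  have hunit : ∀ᶠ y in 𝓝 x, IsUnit (A y) := by
    have : ∀ᶠ B in 𝓝 (A x), IsUnit B := by
      rw [hAx]
      exact Units.nhds (1 : (V →L[ℝ] V)ˣ)
    exact hA.continuousAt this
  refine (hinv.clm_apply hK).congr_of_eventuallyEq ?_
  filter_upwards [h, hunit] with y hy hu
  rw [← hy, ← mul_apply_eq_comp, Ring.inverse_mul_cancel _ hu]
  rfl

variable [I.Boundaryless]

theorem contMDiffAt_koszul_extendField (x : M) (u v w : TangentSpace I x) :
    ContMDiffAt I 𝓘(ℝ, ℝ) 1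
      (fun y => koszul I (extendField u) (extendField v) (extendField w) y) x := by
  have hx := mem_baseSet_trivializationAt' (F := E) (E := TangentSpace I) x
  have hE (n : ℕ∞) (u : TangentSpace I x) := contMDiffAt_extendField (n := n) hx u
  have : IsManifold I ((2 : ℕ∞) + 1) M := IsManifold.of_le (n := ∞) (by norm_cast)
  have : IsManifold I (minSmoothness ℝ 2) M := by
    rw [minSmoothness_of_isRCLikeNormedField]
    exact IsManifold.of_le (n := ∞) (by norm_cast)
  have : CompleteSpace E := FiniteDimensional.complete ℝ E
  have hin {n : ℕ∞} {A B : Π y : M, TangentSpace I y} (hA : CMDiffAt n (T% A) x)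
      (hB : CMDiffAt n (T% B) x) :
      ContMDiffAt I 𝓘(ℝ, ℝ) n (fun y => inner ℝ (A y) (B y)) x := by
    have : IsContMDiffRiemannianBundle I n E (fun x : M => TangentSpace I x) :=
      IsContMDiffRiemannianBundle.of_le (n := ∞) (by exact_mod_cast le_top)
    exact ContMDiffAt.inner_bundle (IB := I) (F := E) (E := fun x : M => TangentSpace I x)
      (b := fun y => y) hA hB
  have hbr (u v : TangentSpace I x) :
      CMDiffAt (1 : ℕ∞) (T% (mlieBracket I (extendField u) (extendField v))) x :=
    ContMDiffAt.mlieBracket_vectorField (n := 2) (m := 1) (hE 2 u) (hE 2 v) (by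
      rw [minSmoothness_of_isRCLikeNormedField]; norm_cast)
  have hd (u v w : TangentSpace I x) := contMDiffAt_mvfderiv_extendField
    (hin (n := 2) (hE 2 v) (hE 2 w)) u
  have h := (((((hd u v w).add (hd v u w)).sub (hd w u v)).add
    (hin (hbr u v) (hE 1 w))).sub (hin (hbr u w) (hE 1 v))).sub (hin (hbr v w) (hE 1 u))
  exact h.div_const 2

/-- The Christoffel symbols along a coordinate field are continuously differentiable. -/
theorem contMDiffAt_frameChristoffel (x : M) (e : TangentSpace I x) :
    ContMDiffAt I 𝓘(ℝ, TangentSpace I x →L[ℝ] TangentSpace I x) 1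
      (fun y => frameChristoffel x y (extendField e y)) x := by
  refine contMDiffAt_clm_of_apply (n := 1) fun u => ?_
  have hx := mem_baseSet_trivializationAt' (F := E) (E := TangentSpace I) x
  have hE (u : TangentSpace I x) := contMDiffAt_extendField (n := 1) hx u
  let b := stdOrthonormalBasis ℝ (TangentSpace I x)
  -- `A` is the Gram operator of the frame `extendField (b k)`, equal to the identity at `x` because
  -- `b` is orthonormal. `K` collects the Koszul expressions, and `A` applied to the Christoffel
  -- symbol is `K`.
  let A : M → TangentSpace I x →L[ℝ] TangentSpace I x := fun y =>
    ∑ k, ((innerSL ℝ (extendField (b k) y)).comp (tangentTransition x y)).smulRight (b k)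
  let K : M → TangentSpace I x := fun y =>
    ∑ k, koszul I (extendField e) (extendField u) (extendField (b k)) y • b k
  have hA : ContMDiffAt I 𝓘(ℝ, TangentSpace I x →L[ℝ] TangentSpace I x) 1 A x := by
    refine contMDiffAt_clm_of_apply (n := 1) fun v => ?_
    have : (fun y => A y v) = fun y => ∑ k, inner ℝ (extendField (b k) y) (extendField v y) • b k := by
      ext y
      simp only [A, sum_apply]
      rfl
    rw [this]
    refine contMDiffAt_finsetSum fun k _ => ?_
    have hi : ContMDiffAt I 𝓘(ℝ, ℝ) 1 (fun y => inner ℝ (extendField (b k) y) (extendField v y)) x :=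
      ContMDiffAt.inner_bundle (IB := I) (F := E) (E := fun x : M => TangentSpace I x)
        (b := fun y => y) (hE (b k)) (hE v)
    exact hi.smul contMDiffAt_const
  have hK : ContMDiffAt I 𝓘(ℝ, TangentSpace I x) 1 K x :=
    contMDiffAt_finsetSum fun k _ =>
      (contMDiffAt_koszul_extendField x e u (b k)).smul contMDiffAt_const
  have hAx : A x = 1 := by
    ext v
    have h1 : A x v = ∑ k, inner ℝ (extendField (b k) x) (extendField v x) • b k := by
      simp only [A, sum_apply]
      rfl
    simp only [h1, extendField_self]
    exact b.sum_repr' v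
  have hAK : ∀ᶠ y in 𝓝 x, A y (frameChristoffel x y (extendField e y) u) = K y := by
    filter_upwards [(trivializationAt E (TangentSpace I) x).open_baseSet.mem_nhds hx] with y hy
    simp only [A, K, sum_apply]
    refine Finset.sum_congr rfl fun k _ => ?_
    change inner ℝ (extendField (b k) y) (extendField (frameChristoffel x y (extendField e y) u) y)
      • b k = _
    rw [frameChristoffel_apply, extendField_tangentTransitionBack hy, real_inner_comm,
      inner_leviCivita_eq_koszul (mdifferentiableAt_extendField_of_mem hy e)
        (mdifferentiableAt_extendField_of_mem hy u)
        (mdifferentiableAt_extendField_of_mem hy (b k))]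
  exact contMDiffAt_of_clm_apply_eq (n := 1) hA hK hAx hAK

end

/-! ### Covariant derivatives of curvature tensors in a fixed trivialization -/

section
open FiberBundle
variable {E : Type*} [NormedAddCommGroup E] [NormedSpace ℝ E] [FiniteDimensional ℝ E]
  {H : Type*} [TopologicalSpace H] {I : ModelWithCorners ℝ E H}
  {M : Type*} [TopologicalSpace M] [ChartedSpace H M] [IsManifold I ∞ M]
  [RiemannianBundle (fun x : M => TangentSpace I x)]
  [IsContMDiffRiemannianBundle I ∞ E (fun x : M => TangentSpace I x)]

/-- A section of the bundle of algebraic curvature tensors, read in the trivialization of the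
tangent bundle around `x`. -/
noncomputable def curvCoord (R : Π y : M, AlgCurv (TangentSpace I y)) (x y : M) :
    AlgCurv (TangentSpace I x) :=
  (R y).pullback (tangentTransition x y)

theorem eval_curvCoord (R : Π y : M, AlgCurv (TangentSpace I y)) (x y : M)
    (u v w z : TangentSpace I x) :
    (curvCoord R x y).eval u v w z =
      (R y).eval (extendField u y) (extendField v y) (extendField w y) (extendField z y) :=
  AlgCurv.eval_pullback _ _ _ _ _ _

theorem curvCoord_self (R : Π y : M, AlgCurv (TangentSpace I y)) (x : M) :
    curvCoord R x x = R x :=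
  AlgCurv.ext_eval fun u v w z => by simp only [eval_curvCoord, extendField_self]

theorem covDeriv_eq (R : Π y : M, AlgCurv (TangentSpace I y)) (x : M) (v : TangentSpace I x) :
    covDeriv R x v = mvfderiv I (curvCoord R x) x v - (R x).act (christoffelEnd x v) := rfl

theorem christoffelEnd_add (x : M) (v v' : TangentSpace I x) :
    christoffelEnd x (v + v') = christoffelEnd x v + christoffelEnd x v' := by
  ext u
  exact (leviCivita I M (extendField u) x).map_add v v'

theorem christoffelEnd_smul (x : M) (c : ℝ) (v : TangentSpace I x) :
    christoffelEnd x (c • v) = c • christoffelEnd x v := by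
  ext u
  exact (leviCivita I M (extendField u) x).map_smul c v

theorem covDeriv_add (R : Π y : M, AlgCurv (TangentSpace I y)) (x : M) (v v' : TangentSpace I x) :
    covDeriv R x (v + v') = covDeriv R x v + covDeriv R x v' := by
  rw [covDeriv_eq, covDeriv_eq, covDeriv_eq, christoffelEnd_add, AlgCurv.act_add_left, map_add]
  exact add_sub_add_comm _ _ _ _

theorem covDeriv_smul (R : Π y : M, AlgCurv (TangentSpace I y)) (x : M) (c : ℝ)
    (v : TangentSpace I x) : covDeriv R x (c • v) = c • covDeriv R x v := by
  rw [covDeriv_eq, covDeriv_eq, christoffelEnd_smul, AlgCurv.act_smul_left, map_smul]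
  exact (smul_sub _ _ _).symm

theorem covDeriv_section_add {R S : Π y : M, AlgCurv (TangentSpace I y)} {x : M}
    (hR : MDifferentiableAt I 𝓘(ℝ, AlgCurv (TangentSpace I x)) (curvCoord R x) x)
    (hS : MDifferentiableAt I 𝓘(ℝ, AlgCurv (TangentSpace I x)) (curvCoord S x) x)
    (v : TangentSpace I x) :
    covDeriv (fun y => R y + S y) x v = covDeriv R x v + covDeriv S x v := by
  have e : curvCoord (fun y => R y + S y) x = curvCoord R x + curvCoord S x := by
    funext y
    exact AlgCurv.ext_eval fun u v w z => by
      rw [Pi.add_apply, AlgCurv.eval_add]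
      simp only [eval_curvCoord, AlgCurv.eval_add]
  rw [covDeriv_eq, covDeriv_eq, covDeriv_eq, e, mvfderiv_add hR hS, AlgCurv.act_add_right]
  exact add_sub_add_comm _ _ _ _

theorem covDeriv_section_smul {R : Π y : M, AlgCurv (TangentSpace I y)} {x : M}
    (hR : MDifferentiableAt I 𝓘(ℝ, AlgCurv (TangentSpace I x)) (curvCoord R x) x) (c : ℝ)
    (v : TangentSpace I x) :
    covDeriv (fun y => c • R y) x v = c • covDeriv R x v := by
  have e : curvCoord (fun y => c • R y) x =
      fun y => (c • ContinuousLinearMap.id ℝ (AlgCurv (TangentSpace I x))) (curvCoord R x y) := by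
    funext y
    exact AlgCurv.ext_eval fun u v w z => by
      change _ = (c • curvCoord R x y).eval u v w z
      rw [AlgCurv.eval_smul]
      simp only [eval_curvCoord, AlgCurv.eval_smul]
  rw [covDeriv_eq, covDeriv_eq, e, mvfderiv_clm_comp _ hR, AlgCurv.act_smul_right]
  exact (smul_sub c (mvfderiv I (curvCoord R x) x v) ((R x).act (christoffelEnd x v))).symm

variable [I.Boundaryless]

theorem hasDerivAt_comp_chartLine {F : Type*} [NormedAddCommGroup F] [NormedSpace ℝ F] {y : M}
    {f : M → F} (hf : MDifferentiableAt I 𝓘(ℝ, F) f y) (v : TangentSpace I y) :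
    HasDerivAt (fun s => f (chartLine y v s)) (mvfderiv I f y v) 0 := by
  have ht := (eventually_chartLine_mem_target y v).self_of_nhds
  have hf' : MDifferentiableAt I 𝓘(ℝ, F) f (chartLine y v 0) := by rwa [chartLine_zero]
  have h := hasDerivAt_comp_curve ((contMDiffAt_chartLine ht).mdifferentiableAt (by simp)) hf'
  have e : mvfderiv I f (chartLine y v 0) (extendField v (chartLine y v 0)) = mvfderiv I f y v := by
    rw [chartLine_zero, extendField_self]
  rwa [hasMFDerivAt_chartLine ht, e] at h

/-- The covariant derivative in the trivialization around `x`. -/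
theorem pullback_covDeriv {R : Π y : M, AlgCurv (TangentSpace I y)} {x y : M}
    (hy : y ∈ (trivializationAt E (TangentSpace I) x).baseSet)
    (hRx : MDifferentiableAt I 𝓘(ℝ, AlgCurv (TangentSpace I x)) (curvCoord R x) y)
    (hRy : MDifferentiableAt I 𝓘(ℝ, AlgCurv (TangentSpace I y)) (curvCoord R y) y)
    (v : TangentSpace I y) :
    (covDeriv R y v).pullback (tangentTransition x y) =
      mvfderiv I (curvCoord R x) y v - (curvCoord R x y).act (frameChristoffel x y v) := by
  refine AlgCurv.ext_eval fun u₁ u₂ u₃ u₄ => ?_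
  -- The function `R(U₁, U₂, U₃, U₄)`, with `U_a` extended from `x`, is differentiated along a chart
  -- line at `y` in two ways. In the trivialization around `x` the arguments are constant. In the
  -- trivialization around `y` the product rule applies to the varying coordinates of the `U_a`.
  have h1 := AlgCurv.hasDerivAt_eval_const (hasDerivAt_comp_chartLine hRx v) u₁ u₂ u₃ u₄
  have hyy := mem_baseSet_trivializationAt' (F := E) (E := TangentSpace I) y
  have hX (u : TangentSpace I x) := mdifferentiableAt_extendField_of_mem hy u
  have hd (u : TangentSpace I x) := hasDerivAt_comp_chartLine
    (mdifferentiableAt_tangentTransitionBack hyy (hX u)) v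
  have h2 := AlgCurv.hasDerivAt_eval (hasDerivAt_comp_chartLine hRy v) (hd u₁) (hd u₂) (hd u₃) (hd u₄)
  have hcont : ContinuousAt (chartLine y v) 0 :=
    (contMDiffAt_chartLine (eventually_chartLine_mem_target y v).self_of_nhds).continuousAt
  have hev : ∀ᶠ s in 𝓝 (0 : ℝ),
      chartLine y v s ∈ (trivializationAt E (TangentSpace I) y).baseSet := by
    refine hcont ?_
    rw [chartLine_zero]
    exact (trivializationAt E (TangentSpace I) y).open_baseSet.mem_nhds hyy
  have h3 := h2.unique (h1.congr_of_eventuallyEq (by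
    filter_upwards [hev] with s hs
    simp only [eval_curvCoord, extendField_tangentTransitionBack hs]))
  -- The coordinates around `y` of the field extended from `x` change at the rate `∇_v U - Γ U`,
  -- with `Γ` the Christoffel endomorphism at `y`. The `Γ` terms recombine into `covDeriv`, the `∇_v
  -- U` terms into the action of `frameChristoffel`.
  have hcov (u : TangentSpace I x) : mvfderiv I (fun z => tangentTransitionBack y z (extendField u z)) y v
      = leviCivita I M (extendField u) y v + -christoffelEnd y v (extendField u y) := by
    have h := tangentTransitionBack_leviCivita hyy (hX u) v
    rw [tangentTransitionBack_self, tangentTransitionBack_self, frameChristoffel_self] at h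
    rw [h, add_neg_cancel_right]
  have hΓ (u : TangentSpace I x) :
      extendField (frameChristoffel x y v u) y = leviCivita I M (extendField u) y v := by
    rw [frameChristoffel_apply, extendField_tangentTransitionBack hy]
  have e0 : curvCoord R y (chartLine y v 0) = R y := by rw [chartLine_zero, curvCoord_self]
  have e1 (u : TangentSpace I x) :
      tangentTransitionBack y (chartLine y v 0) (extendField u (chartLine y v 0)) = extendField u y := by
    rw [chartLine_zero, tangentTransitionBack_self]
  simp only [e0, e1, hcov, AlgCurv.eval_add₁, AlgCurv.eval_add₂, AlgCurv.eval_add₃,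
    AlgCurv.eval_add₄, AlgCurv.eval_neg₁, AlgCurv.eval_neg₂, AlgCurv.eval_neg₃,
    AlgCurv.eval_neg₄] at h3
  rw [AlgCurv.eval_pullback, covDeriv_eq, AlgCurv.eval_sub, AlgCurv.eval_sub, AlgCurv.eval_act,
    AlgCurv.eval_act, ← h3]
  simp only [eval_curvCoord, hΓ]
  change (mvfderiv I (curvCoord R y) y v).eval (extendField u₁ y) (extendField u₂ y)
    (extendField u₃ y) (extendField u₄ y) - ((R y).eval (christoffelEnd y v (extendField u₁ y))
      (extendField u₂ y) (extendField u₃ y) (extendField u₄ y)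
    + (R y).eval (extendField u₁ y) (christoffelEnd y v (extendField u₂ y))
      (extendField u₃ y) (extendField u₄ y)
    + (R y).eval (extendField u₁ y) (extendField u₂ y) (christoffelEnd y v (extendField u₃ y))
      (extendField u₄ y)
    + (R y).eval (extendField u₁ y) (extendField u₂ y) (extendField u₃ y)
      (christoffelEnd y v (extendField u₄ y))) = _
  ring

theorem IsSmoothCurvSection.contMDiffAt_curvCoord {R : Π y : M, AlgCurv (TangentSpace I y)}
    (hR : IsSmoothCurvSection R) (x : M) :
    ContMDiffAt I 𝓘(ℝ, AlgCurv (TangentSpace I x)) 2 (curvCoord R x) x :=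
  (hR x).of_le (by norm_cast)

theorem IsSmoothCurvSection.eventually_mdifferentiableAt
    {R : Π y : M, AlgCurv (TangentSpace I y)} (hR : IsSmoothCurvSection R) (x : M) :
    ∀ᶠ y in 𝓝 x, MDifferentiableAt I 𝓘(ℝ, AlgCurv (TangentSpace I x)) (curvCoord R x) y := by
  filter_upwards [(contMDiffAt_iff_contMDiffAt_nhds (by simp)).1 (hR.contMDiffAt_curvCoord x)]
    with y hy using hy.mdifferentiableAt (by simp)

/-- The covariant derivative of a smooth section along a coordinate field, in the trivialization
around `x`. -/
theorem IsSmoothCurvSection.eventually_curvCoord_covDeriv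
    {R : Π y : M, AlgCurv (TangentSpace I y)} (hR : IsSmoothCurvSection R) (x : M)
    (e : TangentSpace I x) :
    ∀ᶠ y in 𝓝 x, curvCoord (fun z => covDeriv R z (extendField e z)) x y =
      mvfderiv I (curvCoord R x) y (extendField e y)
        - (curvCoord R x y).act (frameChristoffel x y (extendField e y)) := by
  filter_upwards [hR.eventually_mdifferentiableAt x,
    (trivializationAt E (TangentSpace I) x).open_baseSet.mem_nhds
      (mem_baseSet_trivializationAt' x)] with y hy hy'
  exact pullback_covDeriv hy' hy (hR.eventually_mdifferentiableAt y).self_of_nhds _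

/-- Since `covDeriv` at `y` uses the trivialization around `y`, its regularity in `y` is not visible
from the definition. In the trivialization around `x` it is built from a first derivative of a `C²`
map and from `C¹` Christoffel symbols. -/
theorem IsSmoothCurvSection.mdifferentiableAt_covDeriv
    {R : Π y : M, AlgCurv (TangentSpace I y)} (hR : IsSmoothCurvSection R) (x : M)
    (e : TangentSpace I x) :
    MDifferentiableAt I 𝓘(ℝ, AlgCurv (TangentSpace I x))
      (curvCoord (fun z => covDeriv R z (extendField e z)) x) x := by
  have h1 := contMDiffAt_mvfderiv_extendField (hR.contMDiffAt_curvCoord x) e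
  have h2 : ContMDiffAt I 𝓘(ℝ, AlgCurv (TangentSpace I x)) 1
      (fun y => AlgCurv.actL (TangentSpace I x) (frameChristoffel x y (extendField e y))
        (curvCoord R x y)) x :=
    ((AlgCurv.actL (TangentSpace I x)).contMDiff.contMDiffAt.comp x
      (contMDiffAt_frameChristoffel x e)).clm_apply ((hR.contMDiffAt_curvCoord x).of_le (by norm_num))
  exact ((h1.sub h2).congr_of_eventuallyEq (hR.eventually_curvCoord_covDeriv x e)).mdifferentiableAt
    (by simp)

end

/-! ### The linear equation of a parallel coframe -/

section
variable {V : Type*} [NormedAddCommGroup V] [InnerProductSpace ℝ V] [FiniteDimensional ℝ V]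

/-- Local solutions of the linear matrix equation `W' = W Γ`. -/
theorem exists_hasDerivAt_mul {Γ : ℝ → V →L[ℝ] V} (hΓ : ContDiffAt ℝ 1 Γ 0) :
    ∃ W : ℝ → V →L[ℝ] V, W 0 = 1 ∧
      ∀ᶠ t in 𝓝 0, IsUnit (W t) ∧ HasDerivAt W (W t * Γ t) t := by
  have : CompleteSpace V := FiniteDimensional.complete ℝ V
  -- Time is added as a coordinate, so that the existence theorem for autonomous `C¹` vector fields
  -- applies.
  let F : ℝ × (V →L[ℝ] V) → ℝ × (V →L[ℝ] V) := fun p => (1, p.2 * Γ p.1)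
  have hF : ContDiffAt ℝ 1 F (0, 1) := by
    refine contDiffAt_const.prodMk (contDiffAt_snd.mul ?_)
    exact ContDiffAt.comp (g := Γ) (f := Prod.fst) ((0 : ℝ), (1 : V →L[ℝ] V)) hΓ contDiffAt_fst
  obtain ⟨α, hα0, ε, hε, hα⟩ :=
    hF.exists_forall_mem_closedBall_exists_eq_forall_mem_Ioo_hasDerivAt₀ 0
  rw [zero_sub, zero_add] at hα
  have h1 (t : ℝ) (ht : t ∈ Ioo (-ε) ε) : HasDerivAt (fun s => (α s).1) 1 t := (hα t ht).fst
  have h2 (t : ℝ) (ht : t ∈ Ioo (-ε) ε) :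
      HasDerivAt (fun s => (α s).2) ((α t).2 * Γ (α t).1) t := (hα t ht).snd
  have h0 : (0 : ℝ) ∈ Ioo (-ε) ε := ⟨by linarith, hε⟩
  -- The time coordinate starts at `0` with constant derivative `1`. Its identification with `t`
  -- turns the solution into one of the original equation.
  have ht (t : ℝ) (ht : t ∈ Ioo (-ε) ε) : (α t).1 = t := by
    have hd (s : ℝ) (hs : s ∈ Ioo (-ε) ε) : HasDerivAt (fun s => (α s).1 - s) (1 - 1) s :=
      (h1 s hs).sub (hasDerivAt_id s)
    have := isOpen_Ioo.is_const_of_deriv_eq_zero isPreconnected_Ioo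
      (fun s hs => (hd s hs).differentiableAt.differentiableWithinAt)
      (fun s hs => by rw [(hd s hs).deriv, sub_self]; rfl) ht h0
    simpa [hα0, sub_eq_zero] using this
  have hW0 : (α 0).2 = 1 := by simp [hα0]
  have hcont : Tendsto (fun s => (α s).2) (𝓝 0) (𝓝 1) := hW0 ▸ (h2 0 h0).continuousAt
  refine ⟨fun t => (α t).2, hW0, ?_⟩
  filter_upwards [Ioo_mem_nhds h0.1 h0.2, hcont.eventually (Units.isOpen.mem_nhds isUnit_one)]
    with t htm htu
  refine ⟨htu, ?_⟩
  have h := h2 t htm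
  rwa [ht t htm] at h

end

-- In `(W⁻¹)' = -W⁻¹ W' W⁻¹` the factor `W⁻¹ W'` is `Γ`.
set_option synthInstance.maxHeartbeats 400000 in
set_option maxHeartbeats 1000000 in
theorem HasDerivAt.ringInverse_of_mul {A : Type*} [NormedRing A] [NormedAlgebra ℝ A]
    [CompleteSpace A] {W : ℝ → A} {Γ : A} {t : ℝ} (hW : HasDerivAt W (W t * Γ) t)
    (hu : IsUnit (W t)) :
    HasDerivAt (fun s => Ring.inverse (W s)) (-(Γ * Ring.inverse (W t))) t := by
  obtain ⟨w, hw⟩ := hu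
  have h1 := hasFDerivAt_ringInverse (𝕜 := ℝ) w
  rw [hw] at h1
  refine (h1.comp_hasDerivAt t hW).congr_deriv ?_
  rw [← hw, Ring.inverse_unit]
  simp

section
variable {V : Type*} [NormedAddCommGroup V] [InnerProductSpace ℝ V] [FiniteDimensional ℝ V]

namespace AlgCurv

/-- The derivative of a curve of algebraic curvature tensors read in a moving parallel frame. -/
theorem hasDerivAt_pullback_inverse {W : ℝ → V →L[ℝ] V} {Γ : V →L[ℝ] V} {ρ : ℝ → AlgCurv V}
    {ρ' : AlgCurv V} {t : ℝ} (hW : HasDerivAt W (W t * Γ) t) (hu : IsUnit (W t))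
    (hρ : HasDerivAt ρ ρ' t) :
    HasDerivAt (fun s => (ρ s).pullback (Ring.inverse (W s)))
      ((ρ' - (ρ t).act Γ).pullback (Ring.inverse (W t))) t := by
  have : CompleteSpace V := FiniteDimensional.complete ℝ V
  have hinv := hW.ringInverse_of_mul hu
  have hu' (u : V) : HasDerivAt (fun s => Ring.inverse (W s) u) (-(Γ (Ring.inverse (W t) u))) t := by
    simpa using! hinv.clm_apply (hasDerivAt_const t u)
  refine hasDerivAt_of_eval fun u₁ u₂ u₃ u₄ => ?_
  simp only [eval_pullback]
  refine (hasDerivAt_eval hρ (hu' u₁) (hu' u₂) (hu' u₃) (hu' u₄)).congr_deriv ?_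
  rw [eval_sub, eval_act]
  simp only [eval_neg₁, eval_neg₂, eval_neg₃, eval_neg₄]
  ring

end AlgCurv
end

/-! ### Parallel transport along chart lines -/

section
open FiberBundle
variable {E : Type*} [NormedAddCommGroup E] [NormedSpace ℝ E] [FiniteDimensional ℝ E]
  {H : Type*} [TopologicalSpace H] {I : ModelWithCorners ℝ E H}
  {M : Type*} [TopologicalSpace M] [ChartedSpace H M] [IsManifold I ∞ M]
  [RiemannianBundle (fun x : M => TangentSpace I x)]
  [IsContMDiffRiemannianBundle I ∞ E (fun x : M => TangentSpace I x)]

variable [I.Boundaryless]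

/-- Parallel fields of algebraic curvature tensors in terms of a coframe `W` that is parallel along
`γ`. -/
theorem isParallelAt_pullback {x : M} {γ : ℝ → M} {t : ℝ}
    (hγ : MDifferentiableAt 𝓘(ℝ, ℝ) I γ t)
    (ht : γ t ∈ (trivializationAt E (TangentSpace I) x).baseSet)
    {W : ℝ → TangentSpace I x →L[ℝ] TangentSpace I x}
    (hW : HasDerivAt W ((W t).comp (frameChristoffel x (γ t) (velocity I γ t))) t)
    (a : AlgCurv (TangentSpace I x)) :
    IsParallelAt γ (fun s => a.pullback ((W s).comp (tangentTransitionBack x (γ s)))) t := by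
  -- The equation `W' = W Γ` says exactly that the coframe commutes with covariant differentiation:
  -- the derivative of `W(X)` is `W(∇X)`.
  have hd {X : Π y : M, TangentSpace I y} (hX : MDiffAt (T% X) (γ t)) :
      HasDerivAt (fun s => W s (tangentTransitionBack x (γ s) (X (γ s))))
        (W t (tangentTransitionBack x (γ t) (leviCivita I M X (γ t) (velocity I γ t)))) t := by
    have h1 := hasDerivAt_comp_curve hγ (mdifferentiableAt_tangentTransitionBack ht hX)
    refine (hW.clm_apply h1).congr_deriv ?_
    rw [tangentTransitionBack_leviCivita ht hX, map_add, add_comm]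
    rfl
  intro X Y Z U hX hY hZ hU
  simp only [AlgCurv.eval_pullback, ContinuousLinearMap.comp_apply]
  refine (AlgCurv.hasDerivAt_eval (hasDerivAt_const t a) (hd hX) (hd hY) (hd hZ)
    (hd hU)).congr_deriv ?_
  have h0 (u v w z : TangentSpace I x) : (0 : AlgCurv (TangentSpace I x)).eval u v w z = 0 := rfl
  rw [h0, zero_add]

/-- The parallel transport of a section along a chart line to its initial point, to first order. -/
theorem exists_parallel_coframe (x : M) (e : TangentSpace I x) :
    ∃ W : ℝ → TangentSpace I x →L[ℝ] TangentSpace I x, W 0 = 1 ∧ ∀ᶠ t in 𝓝 0, IsUnit (W t) ∧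
      HasDerivAt W (W t * frameChristoffel x (chartLine x e t)
        (extendField e (chartLine x e t))) t := by
  have hγ := contMDiffAt_chartLine (eventually_chartLine_mem_target x e).self_of_nhds
  have h1 : ContMDiffAt 𝓘(ℝ, ℝ) 𝓘(ℝ, TangentSpace I x →L[ℝ] TangentSpace I x) 1
      (fun t => frameChristoffel x (chartLine x e t) (extendField e (chartLine x e t))) 0 := by
    have h2 : ContMDiffAt I 𝓘(ℝ, TangentSpace I x →L[ℝ] TangentSpace I x) 1
        (fun y => frameChristoffel x y (extendField e y)) (chartLine x e 0) := by
      rw [chartLine_zero]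
      exact contMDiffAt_frameChristoffel x e
    exact ContMDiffAt.comp (g := fun y => frameChristoffel x y (extendField e y)) 0 h2
      (hγ.of_le (by norm_cast))
  exact exists_hasDerivAt_mul h1.contDiffAt

/-- For fixed `t`, pulling the constant tensor `a` back by the coframe gives a parallel field along
the line. It equals `R` at time `t` and `a` at time `0`, so `a` is the parallel transport of `R` to
`x`, and invariance of `C` applies. -/
theorem eventually_parallel_mem {C : ∀ x : M, Set (AlgCurv (TangentSpace I x))}
    (hC : IsParallelInvariant C) {R : Π y : M, AlgCurv (TangentSpace I y)} (hR : ∀ y, R y ∈ C y)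
    {x : M} {e : TangentSpace I x} {W : ℝ → TangentSpace I x →L[ℝ] TangentSpace I x}
    (hW0 : W 0 = 1) (hW : ∀ᶠ t in 𝓝 0, IsUnit (W t) ∧
      HasDerivAt W (W t * frameChristoffel x (chartLine x e t)
        (extendField e (chartLine x e t))) t) :
    ∀ᶠ t in 𝓝 0, (curvCoord R x (chartLine x e t)).pullback (Ring.inverse (W t)) ∈ C x := by
  have hgood := hW.and (eventually_chartLine_mem_target x e)
  obtain ⟨δ, hδ, hball⟩ := Metric.eventually_nhds_iff_ball.1 hgood
  filter_upwards [Metric.ball_mem_nhds 0 hδ] with t ht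
  have hI (s : ℝ) (hs : s ∈ uIcc t 0) : s ∈ Metric.ball (0 : ℝ) δ :=
    (convex_ball (0 : ℝ) δ).ordConnected.uIcc_subset ht (Metric.mem_ball_self hδ) hs
  set a := (curvCoord R x (chartLine x e t)).pullback (Ring.inverse (W t)) with ha
  have hbase (s : ℝ) (hs : s ∈ Metric.ball (0 : ℝ) δ) :
      chartLine x e s ∈ (trivializationAt E (TangentSpace I) x).baseSet :=
    mem_baseSet_iff_mem_extChartAt_source.2 (chartLine_mem_source (hball s hs).2)
  -- Transport runs from time `t` to time `0`. Both signs of `t` are covered, as a two-sided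
  -- neighbourhood of `0` is required for the local maximum.
  have key := hC (chartLine x e)
    (fun s => a.pullback ((W s).comp (tangentTransitionBack x (chartLine x e s)))) t 0
    (fun s hs => contMDiffAt_chartLine (hball s (hI s hs)).2)
    (fun s hs => by
      have h2 := hball s (hI s hs)
      refine isParallelAt_pullback ((contMDiffAt_chartLine h2.2).mdifferentiableAt (by simp))
        (hbase s (hI s hs)) ?_ a
      rw [hasMFDerivAt_chartLine h2.2]
      exact h2.1.2) ?_
  -- The fibre type depends on the base point. With a free point `y` in place of `chartLine x e 0`,
  -- the equality of base points can be substituted.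
  · have h0 (y : M) (hy : y = x)
        (h : a.pullback ((1 : TangentSpace I x →L[ℝ] TangentSpace I x).comp
          (tangentTransitionBack x y)) ∈ C y) : a ∈ C x := by
      subst hy
      convert h using 1
      refine AlgCurv.ext_eval fun u v w z => ?_
      simp only [AlgCurv.eval_pullback, ContinuousLinearMap.comp_apply,
        tangentTransitionBack_self]
      rfl
    simp only [hW0] at key
    exact h0 _ (chartLine_zero x e) key
  · have hu := (hball t ht).1.1
    have hinv (u : TangentSpace I x) : Ring.inverse (W t) (W t u) = u :=
      congrArg (fun L : TangentSpace I x →L[ℝ] TangentSpace I x => L u)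
        (Ring.inverse_mul_cancel (W t) hu)
    convert hR (chartLine x e t) using 1
    refine AlgCurv.ext_eval fun u v w z => ?_
    simp only [ha, AlgCurv.eval_pullback, eval_curvCoord, ContinuousLinearMap.comp_apply, hinv,
      extendField_tangentTransitionBack (hbase t ht)]

/-- The derivative along a chart line of a section read in a parallel frame is its covariant
derivative read in the parallel frame. -/
theorem hasDerivAt_pullback_coframe {S : Π y : M, AlgCurv (TangentSpace I y)} {x : M}
    {e : TangentSpace I x} {W : ℝ → TangentSpace I x →L[ℝ] TangentSpace I x} {t : ℝ}
    (ht : extChartAt I x x + t • chartVector x e ∈ (extChartAt I x).target) (hu : IsUnit (W t))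
    (hW : HasDerivAt W (W t * frameChristoffel x (chartLine x e t)
        (extendField e (chartLine x e t))) t)
    (hS : MDifferentiableAt I 𝓘(ℝ, AlgCurv (TangentSpace I x)) (curvCoord S x) (chartLine x e t)) :
    HasDerivAt (fun s => (curvCoord S x (chartLine x e s)).pullback (Ring.inverse (W s)))
      ((mvfderiv I (curvCoord S x) (chartLine x e t) (extendField e (chartLine x e t))
        - (curvCoord S x (chartLine x e t)).act (frameChristoffel x (chartLine x e t)
          (extendField e (chartLine x e t)))).pullback (Ring.inverse (W t))) t := by
  have h1 := hasDerivAt_comp_curve ((contMDiffAt_chartLine ht).mdifferentiableAt (by simp)) hS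
  rw [hasMFDerivAt_chartLine ht] at h1
  exact AlgCurv.hasDerivAt_pullback_inverse hW hu h1

end

/-! ### The second order inequality at a supporting hypersurface and its trace -/

section
open FiberBundle
variable {E : Type*} [NormedAddCommGroup E] [NormedSpace ℝ E] [FiniteDimensional ℝ E]
  {H : Type*} [TopologicalSpace H] {I : ModelWithCorners ℝ E H}
  {M : Type*} [TopologicalSpace M] [ChartedSpace H M] [IsManifold I ∞ M]
  [RiemannianBundle (fun x : M => TangentSpace I x)]
  [IsContMDiffRiemannianBundle I ∞ E (fun x : M => TangentSpace I x)]
  [I.Boundaryless]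

/-- The covariant derivatives of a section with values in a parallel set `C` satisfy the first and
second order conditions at a point where the section touches a supporting hypersurface. -/
theorem IsSupportingHypersurface.covDeriv_covDeriv
    {C : ∀ x : M, Set (AlgCurv (TangentSpace I x))}
    (hC : IsParallelInvariant C) {R : Π y : M, AlgCurv (TangentSpace I y)}
    (hRs : IsSmoothCurvSection R) (hR : ∀ y, R y ∈ C y) {x : M}
    {N : Set (AlgCurv (TangentSpace I x))} {ν : AlgCurv (TangentSpace I x) → AlgCurv (TangentSpace I x)}
    (hN : IsSupportingHypersurface (C x) N ν (R x)) (e : TangentSpace I x) :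
    inner ℝ (covDeriv R x e) (ν (R x)) = 0 ∧
      inner ℝ (covDeriv (fun y => covDeriv R y (extendField e y)) x e) (ν (R x)) ≤
        secondFundamentalForm N ν (R x) (covDeriv R x e) (covDeriv R x e) := by
  have : CompleteSpace (AlgCurv (TangentSpace I x)) := FiniteDimensional.complete ℝ _
  obtain ⟨W, hW0, hW⟩ := exists_parallel_coframe x e
  have hcont : Tendsto (chartLine x e) (𝓝 0) (𝓝 x) := by
    have := (contMDiffAt_chartLine (eventually_chartLine_mem_target x e).self_of_nhds).continuousAt
    rwa [ContinuousAt, chartLine_zero] at this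
  have hinv (S : Π y : M, AlgCurv (TangentSpace I y)) :
      (curvCoord S x (chartLine x e 0)).pullback (Ring.inverse (W 0)) = S x := by
    rw [chartLine_zero, curvCoord_self, hW0, Ring.inverse_one]
    exact AlgCurv.pullback_id _
  have hr1 : ∀ᶠ t in 𝓝 0,
      HasDerivAt (fun s => (curvCoord R x (chartLine x e s)).pullback (Ring.inverse (W s)))
        ((curvCoord (fun z => covDeriv R z (extendField e z)) x (chartLine x e t)).pullback
          (Ring.inverse (W t))) t := by
    filter_upwards [hW, eventually_chartLine_mem_target x e,
      hcont.eventually (hRs.eventually_mdifferentiableAt x),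
      hcont.eventually (hRs.eventually_curvCoord_covDeriv x e)] with t h1 h2 h3 h4
    rw [h4]
    exact hasDerivAt_pullback_coframe h2 h1.1 h1.2 h3
  -- The first derivative is again a section read in the parallel frame, namely `∇_E R`. The same
  -- differentiation rule thus gives the acceleration.
  have hr2 : HasDerivAt (fun s => (curvCoord (fun z => covDeriv R z (extendField e z)) x
      (chartLine x e s)).pullback (Ring.inverse (W s)))
      (covDeriv (fun y => covDeriv R y (extendField e y)) x e) 0 := by
    have hd : MDifferentiableAt I 𝓘(ℝ, AlgCurv (TangentSpace I x))
        (curvCoord (fun z => covDeriv R z (extendField e z)) x) (chartLine x e 0) := by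
      rw [chartLine_zero]
      exact hRs.mdifferentiableAt_covDeriv x e
    refine (hasDerivAt_pullback_coframe (eventually_chartLine_mem_target x e).self_of_nhds
      hW.self_of_nhds.1 hW.self_of_nhds.2 hd).congr_deriv ?_
    rw [hW0, Ring.inverse_one, chartLine_zero, extendField_self, frameChristoffel_self,
      curvCoord_self, covDeriv_eq _ x e]
    exact AlgCurv.pullback_id _
  have h := hN.second_variation (hinv R) (eventually_parallel_mem hC hR hW0 hW) hr1 hr2
  rwa [hinv, extendField_self] at h

/-- The trace of a bilinear form does not depend on the orthonormal basis. -/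
theorem sum_orthonormalBasis_eq {V : Type*} [NormedAddCommGroup V] [InnerProductSpace ℝ V]
    {ι κ : Type*} [Fintype ι] [Fintype κ] (b : OrthonormalBasis ι ℝ V)
    (b' : OrthonormalBasis κ ℝ V) (B : V →ₗ[ℝ] V →ₗ[ℝ] ℝ) :
    ∑ i, B (b i) (b i) = ∑ j, B (b' j) (b' j) := by
  -- Expanding one argument on each side reduces both traces to the double sum of `⟨b' j, b i⟩ B(b'
  -- j, b i)`.
  have h (i : ι) : B (b i) (b i) = ∑ j, inner ℝ (b' j) (b i) * B (b' j) (b i) := by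
    have := congrArg (fun v => B v (b i)) (b'.sum_repr' (b i))
    simpa using this.symm
  have h' (j : κ) : B (b' j) (b' j) = ∑ i, inner ℝ (b' j) (b i) * B (b' j) (b i) := by
    have := congrArg (B (b' j)) (b.sum_repr' (b' j))
    simpa [real_inner_comm] using this.symm
  rw [Finset.sum_congr rfl fun i _ => h i, Finset.sum_comm, Finset.sum_congr rfl fun j _ => h' j]

/-- A component of the second covariant derivative of a smooth section, as a bilinear form. -/
noncomputable def covDerivCovDerivForm {R : Π y : M, AlgCurv (TangentSpace I y)}
    (hR : IsSmoothCurvSection R) (x : M) (p : AlgCurv (TangentSpace I x)) :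
    TangentSpace I x →ₗ[ℝ] TangentSpace I x →ₗ[ℝ] ℝ :=
  LinearMap.mk₂ ℝ
    (fun u v => inner ℝ (covDeriv (fun y => covDeriv R y (extendField v y)) x u) p)
    (fun u u' v => by rw [covDeriv_add, inner_add_left])
    (fun c u v => by rw [covDeriv_smul, real_inner_smul_left]; rfl)
    -- Linearity in `v` rests on that of `extendField` and on the differentiability of the sections
    -- `∇_V R`.
    (fun u v v' => by
      have e : (fun y => covDeriv R y (extendField (v + v') y)) =
          fun y => covDeriv R y (extendField v y) + covDeriv R y (extendField v' y) := by
        funext y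
        rw [extendField_add, Pi.add_apply, covDeriv_add]
      rw [e, covDeriv_section_add (hR.mdifferentiableAt_covDeriv x v)
        (hR.mdifferentiableAt_covDeriv x v'), inner_add_left])
    (fun c u v => by
      have e : (fun y => covDeriv R y (extendField (c • v) y)) =
          fun y => c • covDeriv R y (extendField v y) := by
        funext y
        rw [extendField_smul, Pi.smul_apply, covDeriv_smul]
      rw [e, covDeriv_section_smul (hR.mdifferentiableAt_covDeriv x v), real_inner_smul_left]
      rfl)

end

theorem mainTheorem5 {n : ℕ} {M : Type*} [TopologicalSpace M] [T2Space M]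
    [SecondCountableTopology M] [ChartedSpace (EuclideanSpace ℝ (Fin n)) M] [IsManifold (𝓡 n) ∞ M]
    [RiemannianBundle (fun x : M => TangentSpace (𝓡 n) x)]
    [IsContMDiffRiemannianBundle (𝓡 n) ∞ (EuclideanSpace ℝ (Fin n))
      (fun x : M => TangentSpace (𝓡 n) x)]
    (C : ∀ x : M, Set (AlgCurv (TangentSpace (𝓡 n) x)))
    (hC_closed : IsClosedInCurvBundle C)
    (hC_parallel : IsParallelInvariant C)
    (hC_convex : ∀ x : M, IsBianchiConvex n (C x))
    (R : ∀ x : M, AlgCurv (TangentSpace (𝓡 n) x))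
    (hR_smooth : IsSmoothCurvSection R)
    (hR_mem : ∀ y : M, R y ∈ C y)
    (x : M) (hRx : R x ∈ frontier (C x))
    (b : OrthonormalBasis (Fin n) ℝ (TangentSpace (𝓡 n) x))
    (hb : SatisfiesSecondBianchi b (fun i => covDeriv R x (b i)))
    (ε : ℝ) (hε : 0 < ε)
    (N : Set (AlgCurv (TangentSpace (𝓡 n) x)))
    (ν : AlgCurv (TangentSpace (𝓡 n) x) → AlgCurv (TangentSpace (𝓡 n) x))
    (hN : IsSupportingHypersurface (C x) N ν (R x))
    (hN_bound : BianchiBound n N ν ε) :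
    inner ℝ (connLaplacian R x) (ν (R x)) ≤ ε * ∑ i, ‖covDeriv R x (b i)‖ ^ 2 := by
  have key := hN.covDeriv_covDeriv hC_parallel hR_smooth hR_mem
  calc inner ℝ (connLaplacian R x) (ν (R x))
      = ∑ i, covDerivCovDerivForm hR_smooth x (ν (R x))
          (stdOrthonormalBasis ℝ (TangentSpace (𝓡 n) x) i)
          (stdOrthonormalBasis ℝ (TangentSpace (𝓡 n) x) i) := by
        rw [connLaplacian, sum_inner]
        refine Finset.sum_congr rfl fun i _ => ?_
        -- The first order condition holds for every tangent vector, in particular for `∇_e E`. The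
        -- correction term of the Laplacian is therefore orthogonal to `ν (R x)`.
        rw [inner_sub_left, (key _).1, sub_zero]
        rfl
    _ = ∑ i, covDerivCovDerivForm hR_smooth x (ν (R x)) (b i) (b i) :=
        sum_orthonormalBasis_eq _ _ _
    _ ≤ ∑ i, secondFundamentalForm N ν (R x) (covDeriv R x (b i)) (covDeriv R x (b i)) :=
        Finset.sum_le_sum fun i _ => (key (b i)).2
    _ ≤ ε * ∑ i, ‖covDeriv R x (b i)‖ ^ 2 :=
        hN_bound (R x) hN.2.1 _ (fun i => (key (b i)).1) ⟨b, hb⟩
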